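/- Let $\overline{\Lambda}$ be a (possibly non-abelian) group with a partial order $\le$ such that $a_1\le a_2$ and $b_1\le b_2$ imply $a_1b_1\le a_2b_2$, and let $\Lambda=\{x\in\overline{\Lambda}: x\ge 1\}$ be its positive cone, a partially ordered monoid. For $x,y\in\Lambda$, call $y$ an upper neighbor of $x$ if $x<y$ and no $z\in\Lambda$ satisfies $x<z<y$. A lower set is a set $A\subseteq\Lambda$ such that $y\in A$ and $x\le y$ imply $x\in A$; let $L(\Lambda)$ be the set of finite lower sets, and $\langle x\rangle=\{y\in\Lambda: y\le x\}$. For lower sets $A,B$ put $AB=\{x\in\Lambda: x\le ab \text{ for some } a\in A,\ b\in B\}$, $A^0=\{1\}$ and $A^n=A\,A^{n-1}$. A path in $A\subseteq\Lambda$ is a (possibly empty) finite sequence $\pi=(\pi_1,\dots,\pi_m)$ of elements of $A$ such that $\pi_1$ is a minimal element of $\Lambda$ and each $\pi_{i+1}$ is an upper neighbor of $\pi_i$; its length is $\ell(\pi)=m$. A maximal path in $A$ is a path in $A$ that cannot be extended to a longer path in $A$; let $\Pi_m(A)$ be the set of these. For $A\in L(\Lambda)$ let $\ell(A)$ be the maximum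 length of a path in $A$ and $\kappa(A)=\log|\Pi_m(A)|$. Assume that $\Lambda$ is locally finite: every $\langle x\rangle$ is finite, $\Lambda$ has finitely many minimal elements, and every element of $\Lambda$ has finitely many upper neighbors. Assume that $\Lambda$ is steady: there is $C\ge 1$ with $\max_{\pi\in\Pi_m(\langle x\rangle)}\ell(\pi)\le C\min_{\pi\in\Pi_m(\langle x\rangle)}\ell(\pi)$ for all $x\in\Lambda$. Let $(\lambda_x)_{x\in\Lambda}$ be real numbers with $\lambda_-(\Lambda):=\inf_{x\in\Lambda}\lambda_x>0$ and with $\lambda_x\ge\lambda_y$ whenever $x\le y$. Let $(X_t)_{t\ge0}$ be the right-continuous Markov jump process on $L(\Lambda)$ with $X_0=\emptyset$ that moves from $A$ to $A\cup\{\alpha\}$ at rate $\lambda_\alpha$, for each minimal element $\alpha$ of $\Lambda\setminus A$; that is, $X$ solves the martingale problem for the generator $(\mathcal{L}f)(A)=\sum_{\alpha}\lambda_\alpha\,(f(A\cup\{\alpha\})-f(A))$, the sum being over the minimal elements $\alpha$ of $\Lambda\setminus A$, and $f:L(\Lambda)\to\mathbb{R}$ ranging over the finitely supported functions. For $A\in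 L(\Lambda)$ let $\tau_A=\inf\{t\ge0: A\subseteq X_t\}$. Then for every nonempty $A\in L(\Lambda)$, each $\tau_{A^n}$ is almost surely finite and square integrable, the limits $\lim_{n\to\infty}\kappa(A^n)/n$ and $\lim_{n\to\infty}\ell(A^n)/n$ exist and are finite, and so does the limit $$g(A):=\lim_{n\to\infty}\frac{\mathbb{E}[\tau_{A^n}]}{n},\qquad\text{with}\qquad g(A)\le\frac{1}{\lambda_-(\Lambda)}\left(\sqrt{\lim_{n\to\infty}\tfrac1n\kappa(A^n)}+\sqrt{\lim_{n\to\infty}\tfrac1n\ell(A^n)}\right)^2.$$ Moreover, $\tau_{A^n}/n\to g(A)$ in $L^2$ as $n\to\infty$. -/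

import Mathlib

open MeasureTheory ProbabilityTheory Filter Topology
open scoped NNReal ENNReal

noncomputable section

namespace CrystalGrowth

section Poset

variable {P : Type*} [PartialOrder P]

/-- Local finiteness of a poset: principal lower sets are finite, there are finitely many minimal
elements, and every element has finitely many upper neighbors (`a ⋖ b` says that `b` is an upper
neighbor of `a`). -/
def IsLocallyFinite (P : Type*) [PartialOrder P] : Prop :=
  (∀ a : P, (Set.Iic a).Finite) ∧ {x : P | IsMin x}.Finite ∧ ∀ a : P, {b : P | a ⋖ b}.Finite

/-- The set `L(P)` of finite lower sets of `P`. -/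
@[ext]
structure FinLowerSet (P : Type*) [PartialOrder P] where
  carrier : Set P
  finite : carrier.Finite
  lower : IsLowerSet carrier

/-- The state space `L(P)` carries the discrete σ-algebra. -/
instance : MeasurableSpace (FinLowerSet P) := ⊤

/-- The empty lower set. -/
def FinLowerSet.empty : FinLowerSet P := ⟨∅, Set.finite_empty, isLowerSet_empty⟩

/-- The growth elements of `A`: the minimal elements of the complement of `A`. -/
def growthElements (A : FinLowerSet P) : Set P := {x | Minimal (fun y => y ∉ A.carrier) x}

/-- The lower set `A ∪ {α}`, for a growth element `α` of `A`. -/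
def FinLowerSet.grow (A : FinLowerSet P) (α : growthElements A) : FinLowerSet P where
  carrier := insert α.1 A.carrier
  finite := A.finite.insert α.1
  lower := by
    intro x y hyx hx
    rcases hx with rfl | hx
    · by_cases hy : y ∈ A.carrier
      · exact Or.inr hy
      · exact Or.inl (le_antisymm hyx (α.2.2 hy hyx))
    · exact Or.inr (A.lower hyx hx)

/-- The generator `(𝓛 f)(A) = ∑_α lam α * (f (A ∪ {α}) - f A)`, the sum being over the growth
elements `α` of `A`; these are finite in number when `P` is locally finite. -/
def generator (lam : P → ℝ) (f : FinLowerSet P → ℝ) (A : FinLowerSet P) : ℝ :=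
  ∑ᶠ α : growthElements A, lam α.1 * (f (A.grow α) - f A)

/-- `X` is the crystal growth process with rates `lam`, started from the empty set: a process with
values in the discrete space `L(P)`, with right-continuous paths, that solves the martingale problem
for the generator, with the finitely supported functions as test functions. -/
structure IsGrowthProcess (lam : P → ℝ) {Ω : Type*} [mΩ : MeasurableSpace Ω] (μ : Measure Ω)
    (ℱ : Filtration ℝ≥0 mΩ) (X : ℝ≥0 → Ω → FinLowerSet P) : Prop where
  adapted : ∀ t, Measurable[ℱ t] (X t)
  initial : ∀ᵐ ω ∂μ, X 0 ω = FinLowerSet.empty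
  rightCts : ∀ᵐ ω ∂μ, ∀ t, ∀ᶠ s in 𝓝[>] t, X s ω = X t ω
  martingale : ∀ f : FinLowerSet P → ℝ, (Function.support f).Finite →
    Martingale (fun (t : ℝ≥0) ω =>
      f (X t ω) - ∫ s in (0 : ℝ)..t, generator lam f (X s.toNNReal ω)) ℱ μ

/-- The time `τ_A = inf {t : A ⊆ X_t}`, which is `∞` on the event that `A` is never covered. -/
def coverTime {Ω : Type*} (X : ℝ≥0 → Ω → FinLowerSet P) (A : Set P) (ω : Ω) : ℝ≥0∞ :=
  ⨅ (t : ℝ≥0) (_ : A ⊆ (X t ω).carrier), (t : ℝ≥0∞)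

/-- The paths in `A`: finite, possibly empty sequences in `A` that start at a minimal element of `P`
and go from each element to an upper neighbor of it. -/
def paths (A : Set P) : Set (List P) :=
  {π | π.IsChain (· ⋖ ·) ∧ (∀ x ∈ π.head?, IsMin x) ∧ ∀ x ∈ π, x ∈ A}

/-- The maximal paths in `A`, that is, those with no proper extension to a path in `A`. (A path that
is contained in another one is an initial segment of it.) -/
def maxPaths (A : Set P) : Set (List P) :=
  {π | π ∈ paths A ∧ ∀ ξ ∈ paths A, π <+: ξ → ξ = π}

/-- The length `ℓ(A)`: the maximum length of a path in `A`. -/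
def len (A : Set P) : ℕ := sSup (List.length '' paths A)

/-- The width `κ(A)`: the logarithm of the number of maximal paths in `A`. -/
def width (A : Set P) : ℝ := Real.log ((maxPaths A).ncard : ℝ)

/-- Steadiness: for some `C ≥ 1` and all `x`, the maximum of the lengths of the maximal paths in
`{y | y ≤ x}` is at most `C` times their minimum. -/
def IsSteady (P : Type*) [PartialOrder P] : Prop :=
  ∃ C : ℝ, 1 ≤ C ∧ ∀ x : P, ∀ π ∈ maxPaths (Set.Iic x), ∀ ξ ∈ maxPaths (Set.Iic x),
    (π.length : ℝ) ≤ C * (ξ.length : ℝ)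

end Poset

section Monoid

/-- The monoid `{x : G | 1 ≤ x}`, with the order and the multiplication of `G`. -/
abbrev Cone (G : Type*) [Group G] [PartialOrder G] [MulLeftMono G] : Type _ :=
  Submonoid.oneLE G

variable {M : Type*} [Monoid M] [PartialOrder M]

/-- The product `AB = {x : x ≤ a b for some a ∈ A and b ∈ B}` of lower sets. -/
def lowerMul (A B : Set M) : Set M := {x | ∃ a ∈ A, ∃ b ∈ B, x ≤ a * b}

/-- The powers `A ^ 0 = {x : x ≤ 1}` and `A ^ (n + 1) = A A ^ n`. -/
def lowerPow (A : Set M) : ℕ → Set M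
  | 0 => Set.Iic 1
  | n + 1 => lowerMul A (lowerPow A n)

end Monoid

end CrystalGrowth

end

/-! Inside a finite lower set `B` the process is autonomous: whether an element of `B` can be added
depends only on the part of the state in `B`. There it is a finite chain that only grows, so the
first two moments of the covering time `τ_B`, as functions `meanTime` and `sqTime` of the starting
state, solve a recursion backwards from the covered states. They are compared by induction over the
states or by the maximum principle `nonpos_of_drift_nonneg`, in place of couplings and the strong
Markov property. Three estimates carry the theorem; `c` is the infimum of the rates.

Upper bound (`meanTime_le`): weigh a state by the sum of `r ^ ℓ` over the sequences that climb in
`B` from its growth elements until they are stuck. For `r = 1 / (1 - u)` the logarithm of the weight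
has drift at most `-c u`, and at the empty state it is at most `κ(B) + ℓ(B) u / (1 - u)`. Hence `E
τ_B ≤ (κ(B) / u + ℓ(B) / (1 - u)) / c`, and optimizing over `u` produces the square of the sum of
the roots.

Superadditivity (`meanTime_add_le`): when `A` gets covered, nothing lies above its last element `a`
yet. The translate `a B` must still be grown from `a` alone, at rates no larger than those in `B`.

Variance (`sqTime_le`): one jump shortens the expected remaining time by at most `1 / c`, so the
variance of `τ_B` is at most `E τ_B / c`.

For `B = A ^ n`, gluing paths makes `ℓ` (up to `1`) and `κ` superadditive. Steadiness bounds `ℓ(A ^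
n)` linearly, bounded branching then bounds `κ(A ^ n)`, and both together bound the mean. Fekete's
lemma gives the three limits, and the variance bound gives convergence in mean square.

The recursions are tied to the actual process by `setIntegral_eq`, which extends the martingale
property from finitely supported functions to functions of the state inside `B`. Dynkin's formula
then yields `integral_coverTime` and `integral_sq_coverTime_le`. -/

noncomputable section

namespace CrystalGrowth

/-! ### Moments of the covering time by backward recursion. -/

section Recursion

variable {P : Type*} [PartialOrder P] {B : Finset P} {S T : Set P} {α : P}

open Classical in
/-- The growth elements of the state `S` that lie in the target `B`. -/
def front (B : Finset P) (S : Set P) : Finset P := {α ∈ B | Minimal (fun y => y ∉ S) α}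

theorem mem_front : α ∈ front B S ↔ α ∈ B ∧ α ∉ S ∧ ∀ y < α, y ∈ S := by
  simp only [front, Finset.mem_filter, minimal_iff_forall_lt, not_not]

theorem front_nonempty (hB : IsLowerSet (B : Set P)) (h : ¬ (B : Set P) ⊆ S) :
    (front B S).Nonempty := by
  obtain ⟨x, hxB, hxS⟩ := Set.not_subset.1 h
  obtain ⟨m, hm⟩ := (B.finite_toSet.subset (Set.sep_subset (B : Set P) (· ∉ S))).exists_minimal
    ⟨x, hxB, hxS⟩
  refine ⟨m, mem_front.2 ⟨hm.1.1, hm.1.2, fun y hy => ?_⟩⟩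
  by_contra hyS
  exact hy.not_ge (hm.2 ⟨hB hy.le hm.1.1, hyS⟩ hy.le)

theorem ncard_sdiff_insert_lt (hα : α ∈ front B S) :
    ((B : Set P) \ insert α S).ncard < ((B : Set P) \ S).ncard := by
  obtain ⟨h1, h2, -⟩ := mem_front.1 hα
  refine Set.ncard_lt_ncard ?_ (B.finite_toSet.subset Set.sdiff_subset)
  refine (Set.ssubset_iff_of_subset (Set.sdiff_subset_sdiff_right (Set.subset_insert _ _))).2
    ⟨α, ⟨h1, h2⟩, by simp⟩

/-- Induction over the states, backwards from the covered ones. -/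
theorem front_induction (B : Finset P) {p : Set P → Prop}
    (h : ∀ S, (∀ α ∈ front B S, p (insert α S)) → p S) (S : Set P) : p S := by
  induction hn : ((B : Set P) \ S).ncard using Nat.strong_induction_on generalizing S with
  | _ n ih =>
    subst hn
    exact h S fun α hα => ih _ (ncard_sdiff_insert_lt hα) _ rfl

/-- The generator, acting on functions that depend only on the part of the state inside `B`. -/
def drift (lam : P → ℝ) (B : Finset P) (f : Set P → ℝ) (S : Set P) : ℝ :=
  ∑ α ∈ front B S, lam α * (f (insert α S) - f S)

open Classical in
/-- The expected value of `∫ q (X s) ds` up to the time when `B` is covered, for the growth process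
started from `S`. -/
def expect (lam : P → ℝ) (B : Finset P) (q : Set P → ℝ) (S : Set P) : ℝ :=
  if (B : Set P) ⊆ S then 0 else
    (q S + ∑ α ∈ (front B S).attach, lam α.1 * expect lam B q (insert α.1 S)) /
      ∑ α ∈ front B S, lam α
termination_by ((B : Set P) \ S).ncard
decreasing_by exact ncard_sdiff_insert_lt α.2

variable {lam : P → ℝ} {q : Set P → ℝ}

theorem expect_of_subset (h : (B : Set P) ⊆ S) : expect lam B q S = 0 := by
  rw [expect, if_pos h]

theorem rate_pos (hlam : ∀ x, 0 < lam x) (hB : IsLowerSet (B : Set P)) (h : ¬ (B : Set P) ⊆ S) :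
    0 < ∑ α ∈ front B S, lam α :=
  Finset.sum_pos (fun x _ => hlam x) (front_nonempty hB h)

theorem rate_mul_expect (hlam : ∀ x, 0 < lam x) (hB : IsLowerSet (B : Set P))
    (h : ¬ (B : Set P) ⊆ S) : (∑ α ∈ front B S, lam α) * expect lam B q S =
      q S + ∑ α ∈ front B S, lam α * expect lam B q (insert α S) := by
  rw [expect, if_neg h, mul_div_cancel₀ _ (rate_pos hlam hB h).ne',
    Finset.sum_attach (front B S) fun α => lam α * expect lam B q (insert α S)]

theorem drift_eq (f : Set P → ℝ) (S : Set P) : drift lam B f S =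
    ∑ α ∈ front B S, lam α * f (insert α S) - (∑ α ∈ front B S, lam α) * f S := by
  simp only [drift, mul_sub, Finset.sum_sub_distrib, Finset.sum_mul]

theorem drift_expect (hlam : ∀ x, 0 < lam x) (hB : IsLowerSet (B : Set P))
    (h : ¬ (B : Set P) ⊆ S) : drift lam B (expect lam B q) S = - q S := by
  rw [drift_eq, rate_mul_expect hlam hB h]
  ring

theorem isLowerSet_insert (hS : IsLowerSet S) (hα : α ∈ front B S) : IsLowerSet (insert α S) := by
  intro x y hyx hx
  rcases hx with rfl | hx
  · rcases hyx.eq_or_lt with rfl | h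
    · exact Or.inl rfl
    · exact Or.inr ((mem_front.1 hα).2.2 _ h)
  · exact Or.inr (hS hyx hx)

/-- The maximum principle. -/
theorem nonpos_of_drift_nonneg (hlam : ∀ x, 0 < lam x) (hB : IsLowerSet (B : Set P))
    {u : Set P → ℝ} (h0 : ∀ S, (B : Set P) ⊆ S → u S ≤ 0)
    (h1 : ∀ S, IsLowerSet S → ¬ (B : Set P) ⊆ S → 0 ≤ drift lam B u S) (hS : IsLowerSet S) :
    u S ≤ 0 := by
  induction S using front_induction B with
  | h S ih =>
    by_cases h : (B : Set P) ⊆ S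
    · exact h0 S h
    · have h2 := h1 S hS h
      rw [drift_eq] at h2
      have h3 : ∑ α ∈ front B S, lam α * u (insert α S) ≤ 0 :=
        Finset.sum_nonpos fun α hα =>
          mul_nonpos_of_nonneg_of_nonpos (hlam α).le (ih α hα (isLowerSet_insert hS hα))
      have h4 := rate_pos hlam hB h
      by_contra! h5
      nlinarith [mul_pos h4 h5]

theorem front_inter (hB : IsLowerSet (B : Set P)) (S : Set P) : front B (S ∩ B) = front B S := by
  ext α
  simp only [mem_front, Set.mem_inter_iff, Finset.mem_coe]
  refine and_congr_right fun h => ?_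
  have : ∀ y < α, y ∈ B := fun y hy => hB hy.le h
  simp only [h, and_true]
  exact and_congr_right fun _ => forall₂_congr fun y hy => by simp [this y hy]

theorem insert_inter (hα : α ∈ front B S) : insert α S ∩ (B : Set P) = insert α (S ∩ B) :=
  Set.insert_inter_of_mem (mem_front.1 hα).1

/-- By `front_inter` the recursion reads only the part of the state in `B`. This locality lets the
moment functions serve as test functions for the process on the whole poset. -/
theorem expect_inter (hlam : ∀ x, 0 < lam x) (hB : IsLowerSet (B : Set P))
    (hq : ∀ S, q (S ∩ B) = q S) (S : Set P) : expect lam B q (S ∩ B) = expect lam B q S := by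
  induction S using front_induction B with
  | h S ih =>
    by_cases h : (B : Set P) ⊆ S
    · rw [expect_of_subset h, expect_of_subset (Set.subset_inter h subset_rfl)]
    · have h' : ¬ (B : Set P) ⊆ S ∩ B := fun h'' => h (h''.trans Set.inter_subset_left)
      have e1 := rate_mul_expect (q := q) hlam hB h
      have e2 := rate_mul_expect (q := q) hlam hB h'
      rw [front_inter hB, hq] at e2
      have e3 : ∑ α ∈ front B S, lam α * expect lam B q (insert α (S ∩ B)) =
          ∑ α ∈ front B S, lam α * expect lam B q (insert α S) :=
        Finset.sum_congr rfl fun α hα => by rw [← insert_inter hα, ih α hα]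
      rw [e3, ← e1] at e2
      exact mul_left_cancel₀ (rate_pos hlam hB h).ne' e2

theorem drift_inter (hB : IsLowerSet (B : Set P)) {f : Set P → ℝ} (hf : ∀ S, f (S ∩ B) = f S)
    (S : Set P) : drift lam B f (S ∩ B) = drift lam B f S := by
  rw [drift, drift, front_inter hB]
  exact Finset.sum_congr rfl fun α hα => by rw [← insert_inter hα, hf, hf]

theorem expect_nonneg (hlam : ∀ x, 0 < lam x) (hB : IsLowerSet (B : Set P))
    (hq : ∀ S, 0 ≤ q S) (S : Set P) : 0 ≤ expect lam B q S := by
  induction S using front_induction B with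
  | h S ih =>
    by_cases h : (B : Set P) ⊆ S
    · rw [expect_of_subset h]
    · have h4 := rate_pos hlam hB h
      refine nonneg_of_mul_nonneg_right ?_ h4
      rw [rate_mul_expect hlam hB h]
      exact add_nonneg (hq S) (Finset.sum_nonneg fun α hα => mul_nonneg (hlam α).le (ih α hα))

/-- The expected time until `B` is covered, starting from `S`. -/
def meanTime (lam : P → ℝ) (B : Finset P) : Set P → ℝ := expect lam B fun _ => 1

/-- The second moment of the time until `B` is covered, starting from `S`. -/
def sqTime (lam : P → ℝ) (B : Finset P) : Set P → ℝ := expect lam B fun S => 2 * meanTime lam B S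

theorem meanTime_nonneg (hlam : ∀ x, 0 < lam x) (hB : IsLowerSet (B : Set P)) (S : Set P) :
    0 ≤ meanTime lam B S :=
  expect_nonneg hlam hB (fun _ => zero_le_one) S

theorem rate_mul_meanTime (hlam : ∀ x, 0 < lam x) (hB : IsLowerSet (B : Set P))
    (h : ¬ (B : Set P) ⊆ S) : (∑ α ∈ front B S, lam α) * meanTime lam B S =
      1 + ∑ α ∈ front B S, lam α * meanTime lam B (insert α S) :=
  rate_mul_expect hlam hB h

/-- Analytic form of the monotone coupling, in which processes started from `S ⊆ T` share their
jumps. Joint jumps (`E`) preserve the inclusion, a jump of `S` to an element of `T` moves only `S`,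
and the remaining growth elements of `T` move only `T`. If the value at `T` were larger, the
comparisons `i1`, `i2`, `i3` would contradict the two recursions. -/
theorem meanTime_antitone (hlam : ∀ x, 0 < lam x) (hB : IsLowerSet (B : Set P)) :
    Antitone (meanTime lam B) := by
  classical
  intro S
  induction S using front_induction B with
  | h S ihS =>
  intro T
  induction T using front_induction B with
  | h T ihT =>
  intro hST
  have hST : S ⊆ T := hST
  by_cases hT : (B : Set P) ⊆ T
  · rw [meanTime, expect_of_subset hT]
    exact meanTime_nonneg hlam hB S
  have hS : ¬ (B : Set P) ⊆ S := fun h => hT (h.trans hST)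
  set m := meanTime lam B with hm
  have key : ∀ α ∈ front B S, α ∉ T → α ∈ front B T := fun α hα h => by
    rw [mem_front] at hα ⊢
    exact ⟨hα.1, h, fun y hy => hST (hα.2.2 y hy)⟩
  have e1 := rate_mul_meanTime (lam := lam) hlam hB hS
  have e2 := rate_mul_meanTime (lam := lam) hlam hB hT
  rw [← hm] at e1 e2
  set E := (front B S).filter (· ∉ T) with hE
  have hET : E ⊆ front B T := fun α hα => key α (Finset.mem_filter.1 hα).1
      (Finset.mem_filter.1 hα).2
  rw [← Finset.sum_filter_add_sum_filter_not (front B S) (· ∉ T),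
    ← Finset.sum_filter_add_sum_filter_not (front B S) (· ∉ T) (fun α => lam α * m (insert α S)),
    ← hE] at e1
  rw [← Finset.sum_sdiff hET, ← Finset.sum_sdiff hET (f := fun α => lam α * m (insert α T))] at e2
  have i1 : ∑ α ∈ E, lam α * m (insert α T) ≤ ∑ α ∈ E, lam α * m (insert α S) :=
    Finset.sum_le_sum fun α hα => mul_le_mul_of_nonneg_left
      (ihS α (Finset.mem_filter.1 hα).1 (Set.insert_subset_insert hST)) (hlam α).le
  have i2 : (∑ α ∈ front B S with ¬ α ∉ T, lam α) * m T ≤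
      ∑ α ∈ front B S with ¬ α ∉ T, lam α * m (insert α S) := by
    rw [Finset.sum_mul]
    refine Finset.sum_le_sum fun α hα => mul_le_mul_of_nonneg_left ?_ (hlam α).le
    obtain ⟨h1, h2⟩ := Finset.mem_filter.1 hα
    exact ihS α h1 (Set.insert_subset (not_not.1 h2) hST)
  have i3 : ∑ α ∈ front B T \ E, lam α * m (insert α T) ≤ (∑ α ∈ front B T \ E, lam α) * m S := by
    rw [Finset.sum_mul]
    exact Finset.sum_le_sum fun α hα => mul_le_mul_of_nonneg_left
      (ihT α (Finset.sdiff_subset hα) (hST.trans (Set.subset_insert _ _))) (hlam α).le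
  have p1 : 0 < ∑ α ∈ front B T \ E, lam α + ∑ α ∈ E, lam α := by
    rw [Finset.sum_sdiff hET]
    exact rate_pos hlam hB hT
  have p2 : 0 ≤ ∑ α ∈ front B S with ¬ α ∉ T, lam α := Finset.sum_nonneg fun α _ => (hlam α).le
  by_contra! h
  nlinarith [mul_pos p1 (sub_pos.2 h), mul_nonneg p2 (sub_pos.2 h).le]

/-- A growth element remains one until it is added, so `α` is waited for during a time of mean `1 /
lam α`. Whatever is added meanwhile only helps, by `meanTime_antitone`. -/
theorem meanTime_le_insert (hlam : ∀ x, 0 < lam x) (hB : IsLowerSet (B : Set P))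
    (hα : α ∈ front B S) : meanTime lam B S ≤ 1 / lam α + meanTime lam B (insert α S) := by
  classical
  induction S using front_induction B with
  | h S ih =>
  have hS : ¬ (B : Set P) ⊆ S := fun h => (mem_front.1 hα).2.1 (h (mem_front.1 hα).1)
  have e1 := rate_mul_meanTime (lam := lam) hlam hB hS
  have i1 : ∑ β ∈ (front B S).erase α, lam β * meanTime lam B (insert β S) ≤
      (∑ β ∈ (front B S).erase α, lam β) * (1 / lam α + meanTime lam B (insert α S)) := by
    rw [Finset.sum_mul]
    refine Finset.sum_le_sum fun β hβ => mul_le_mul_of_nonneg_left ?_ (hlam β).le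
    obtain ⟨h1, h2⟩ := Finset.mem_erase.1 hβ
    have h3 : α ∈ front B (insert β S) := by
      rw [mem_front] at hα ⊢
      refine ⟨hα.1, ?_, fun y hy => Or.inr (hα.2.2 y hy)⟩
      simpa [Ne.symm h1] using hα.2.1
    refine (ih β h2 h3).trans (add_le_add_right (meanTime_antitone hlam hB ?_) _)
    exact Set.insert_subset_insert (Set.subset_insert _ _)
  rw [← Finset.add_sum_erase _ _ hα, ← Finset.add_sum_erase _ _ hα] at e1
  have p2 : 0 ≤ ∑ β ∈ (front B S).erase α, lam β := Finset.sum_nonneg fun α _ => (hlam α).le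
  have p3 : lam α * (1 / lam α) = 1 := mul_one_div_cancel (hlam α).ne'
  by_contra! h
  nlinarith [mul_pos (hlam α) (sub_pos.2 h), mul_nonneg p2 (sub_pos.2 h).le]

/-- The variance of the covering time is at most its mean divided by a lower bound of the rates. -/
theorem sqTime_le {c : ℝ} (hc : 0 < c) (hlam : ∀ x, c ≤ lam x) (hB : IsLowerSet (B : Set P))
    (hS : IsLowerSet S) :
    sqTime lam B S ≤ meanTime lam B S ^ 2 + meanTime lam B S / c := by
  have hlam' : ∀ x, 0 < lam x := fun x => hc.trans_le (hlam x)
  set h := meanTime lam B with hh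
  suffices sqTime lam B S - (h S ^ 2 + h S / c) ≤ 0 by linarith
  refine nonpos_of_drift_nonneg (u := fun S => sqTime lam B S - (h S ^ 2 + h S / c)) hlam' hB
    (fun S hS => ?_) (fun S _ hS => ?_) hS
  · simp [sqTime, hh, meanTime, expect_of_subset hS]
  · have e1 : drift lam B (sqTime lam B) S = - (2 * h S) := drift_expect hlam' hB hS
    have e2 : drift lam B h S = -1 := drift_expect hlam' hB hS
    have e3 : ∀ α, lam α * (sqTime lam B (insert α S) - (h (insert α S) ^ 2 + h (insert α S) / c) -
        (sqTime lam B S - (h S ^ 2 + h S / c))) =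
        lam α * (sqTime lam B (insert α S) - sqTime lam B S) -
        (2 * h S) * (lam α * (h (insert α S) - h S)) -
        (lam α * (h (insert α S) - h S) ^ 2 + (1 / c) * (lam α * (h (insert α S) - h S))) := by
      intro α
      ring
    -- The squares measure how far the drift of `h ^ 2` exceeds `2 * h` times the drift of `h`. Each
    -- jump `Δ` of `h` lies in `[-1/c, 0]`, so `Δ ^ 2 + Δ / c ≤ 0`.
    have e4 : ∑ α ∈ front B S,
        (lam α * (h (insert α S) - h S) ^ 2 + (1 / c) * (lam α * (h (insert α S) - h S))) ≤ 0 := by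
      refine Finset.sum_nonpos fun α hα => ?_
      have h1 : h (insert α S) ≤ h S := meanTime_antitone hlam' hB (Set.subset_insert _ _)
      have h2 := meanTime_le_insert hlam' hB hα
      have h3 : 1 / lam α ≤ 1 / c := one_div_le_one_div_of_le hc (hlam α)
      have h4 : lam α * (h (insert α S) - h S) ^ 2 + (1 / c) * (lam α * (h (insert α S) - h S)) =
        - (lam α * ((h S - h (insert α S)) * (1 / c + h (insert α S) - h S))) := by ring
      rw [h4]
      exact neg_nonpos.2 (mul_nonneg (hlam' α).le (mul_nonneg (by linarith) (by linarith)))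
    simp only [drift] at e1 e2 ⊢
    simp only [e3, Finset.sum_sub_distrib, ← Finset.mul_sum]
    rw [e1, e2]
    linarith

end Recursion

end CrystalGrowth

end

noncomputable section

namespace CrystalGrowth

/-! ### Weighted paths and the upper bound on the mean covering time. -/

section Paths

variable {P : Type*} [PartialOrder P] {A : Set P} {π ξ : List P} {x y : P}

theorem nil_mem_paths : ([] : List P) ∈ paths A := by simp [paths]

theorem append_mem_paths (h : π ++ [x] ∈ paths A) (hxy : x ⋖ y) (hy : y ∈ A) :
    π ++ [x] ++ [y] ∈ paths A := by
  obtain ⟨h1, h2, h3⟩ := h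
  refine ⟨List.isChain_append.2 ⟨h1, by simp, by simpa using hxy⟩, fun z hz => h2 z ?_, ?_⟩
  · cases π <;> simp_all
  · intro z hz
    rcases List.mem_append.1 hz with hz | hz
    · exact h3 z hz
    · rw [List.mem_singleton.1 hz]
      exact hy

theorem nodup_of_mem_paths (h : π ∈ paths A) : π.Nodup := by
  have h1 : π.IsChain (· < ·) := h.1.imp fun _ _ h => h.lt
  exact (List.isChain_iff_pairwise.1 h1).imp fun h => h.ne

theorem finite_paths (hA : A.Finite) : (paths A).Finite := by
  refine (List.finite_length_le hA.toFinset hA.toFinset.card |>.image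
    (List.map Subtype.val)).subset fun π hπ => ?_
  lift π to List hA.toFinset using fun x hx => hA.mem_toFinset.2 (hπ.2.2 x hx)
  refine ⟨π, ?_, rfl⟩
  have h := (List.Nodup.of_map _ (nodup_of_mem_paths hπ)).length_le_card
  simpa using h

theorem finite_maxPaths (hA : A.Finite) : (maxPaths A).Finite :=
  (finite_paths hA).subset fun _ h => h.1

theorem length_le_len (hA : A.Finite) (h : π ∈ paths A) : π.length ≤ len A :=
  le_csSup ((finite_paths hA).image _).bddAbove ⟨π, h, rfl⟩

theorem exists_length_eq_len (hA : A.Finite) : ∃ π ∈ paths A, π.length = len A :=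
  Nat.sSup_mem (s := List.length '' paths A) ⟨_, [], nil_mem_paths, rfl⟩
    ((finite_paths hA).image _).bddAbove

theorem exists_maxPaths (hA : A.Finite) (h : π ∈ paths A) : ∃ ξ ∈ maxPaths A, π <+: ξ := by
  obtain ⟨ξ, ⟨h1, h2⟩, h3⟩ := ((finite_paths hA).subset
    (Set.sep_subset (paths A) (π <+: ·))).exists_maximalFor List.length _ ⟨π, h, List.prefix_rfl⟩
  refine ⟨ξ, ⟨h1, fun ζ hζ hp => ?_⟩, h2⟩
  exact (hp.eq_of_length_le (h3 ⟨hζ, h2.trans hp⟩ hp.length_le)).symm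

theorem maxPaths_nonempty (hA : A.Finite) : (maxPaths A).Nonempty :=
  let ⟨ξ, h, _⟩ := exists_maxPaths hA nil_mem_paths
  ⟨ξ, h⟩

open Classical in
/-- The upper neighbors of `x` in `B`. -/
def upper (B : Finset P) (x : P) : Finset P := {y ∈ B | x ⋖ y}

theorem mem_upper {B : Finset P} : y ∈ upper B x ↔ y ∈ B ∧ x ⋖ y := by simp [upper]

theorem ncard_inter_Ioi_lt {B : Finset P} (h : y ∈ upper B x) :
    ((B : Set P) ∩ Set.Ioi y).ncard < ((B : Set P) ∩ Set.Ioi x).ncard := by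
  obtain ⟨h1, h2⟩ := mem_upper.1 h
  refine Set.ncard_lt_ncard ?_ (B.finite_toSet.subset Set.inter_subset_left)
  refine (Set.ssubset_iff_of_subset ?_).2 ⟨y, ⟨h1, h2.lt⟩, by simp⟩
  exact Set.inter_subset_inter_right _ (Set.Ioi_subset_Ioi h2.le)

open Classical in
/-- The sum of `r ^ ℓ(π)` over the sequences `π` in `B` that start at `x`, go from each element to
an upper neighbor, and cannot be continued in `B`. -/
def pathWeight (r : ℝ) (B : Finset P) (x : P) : ℝ :=
  r * if upper B x = ∅ then 1 else ∑ y ∈ (upper B x).attach, pathWeight r B y.1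
termination_by ((B : Set P) ∩ Set.Ioi x).ncard
decreasing_by exact ncard_inter_Ioi_lt y.2

variable {r : ℝ} {B : Finset P}

theorem pathWeight_of_eq_empty (h : upper B x = ∅) : pathWeight r B x = r := by
  rw [pathWeight, if_pos h, mul_one]

theorem pathWeight_of_nonempty (h : (upper B x).Nonempty) :
    pathWeight r B x = r * ∑ y ∈ upper B x, pathWeight r B y := by
  rw [pathWeight, if_neg h.ne_empty, Finset.sum_attach (upper B x) (pathWeight r B)]

theorem upper_induction (B : Finset P) {p : P → Prop} (h : ∀ x, (∀ y ∈ upper B x, p y) → p x)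
    (x : P) : p x := by
  induction hn : ((B : Set P) ∩ Set.Ioi x).ncard using Nat.strong_induction_on generalizing x with
  | _ n ih =>
    subst hn
    exact h x fun y hy => ih _ (ncard_inter_Ioi_lt hy) _ rfl

theorem le_pathWeight (hr : 1 ≤ r) (x : P) : r ≤ pathWeight r B x := by
  induction x using upper_induction B with
  | h x ih =>
    rcases (upper B x).eq_empty_or_nonempty with h | h
    · exact (pathWeight_of_eq_empty h).ge
    · rw [pathWeight_of_nonempty h]
      obtain ⟨y, hy⟩ := h
      have h1 : pathWeight r B y ≤ ∑ y ∈ upper B x, pathWeight r B y :=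
        Finset.single_le_sum (f := pathWeight r B) (fun z hz => by linarith [ih z hz]) hy
      nlinarith [ih y hy]

open Classical in
/-- The number of maximal paths in `B` that extend `π`. -/
def extensions (B : Finset P) (π : List P) : ℕ :=
  ((finite_maxPaths B.finite_toSet).toFinset.filter (π <+: ·)).card

theorem sum_extensions_le (Y : Finset P) (π : List P) :
    ∑ y ∈ Y, extensions B (π ++ [y]) ≤ extensions B π := by
  classical
  unfold extensions
  rw [← Finset.card_biUnion]
  · refine Finset.card_le_card fun ξ => ?_
    simp only [Finset.mem_biUnion, Finset.mem_filter]
    rintro ⟨y, -, h1, h2⟩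
    exact ⟨h1, (List.prefix_append _ _).trans h2⟩
  · intro y _ z _ hyz
    refine Finset.disjoint_left.2 fun ξ h1 h2 => hyz ?_
    have h3 := List.prefix_of_prefix_length_le (Finset.mem_filter.1 h1).2 (Finset.mem_filter.1 h2).2
      (by simp)
    simpa using h3.eq_of_length (by simp)

/-- Each sequence counted by `pathWeight` completes `π` to a maximal path in `B`, of length at most
`len B`. The factor `r ^ π.length` turns its weight into that of the whole path. -/
theorem pathWeight_mul_le (hr : 1 ≤ r) (π : List P) (x : P) (h : π ++ [x] ∈ paths (B : Set P)) :
    pathWeight r B x * r ^ π.length ≤ extensions B (π ++ [x]) * r ^ len (B : Set P) := by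
  classical
  induction x using upper_induction B generalizing π with
  | h x ih =>
    rcases (upper B x).eq_empty_or_nonempty with h0 | h0
    · rw [pathWeight_of_eq_empty h0, ← pow_succ']
      have h1 : π.length + 1 ≤ len (B : Set P) := by
        simpa using length_le_len B.finite_toSet h
      have h2 : 1 ≤ extensions B (π ++ [x]) := by
        obtain ⟨ξ, h1, h2⟩ := exists_maxPaths B.finite_toSet h
        exact Finset.card_pos.2 ⟨ξ, Finset.mem_filter.2 ⟨by simpa using h1, h2⟩⟩
      calc r ^ (π.length + 1) ≤ r ^ len (B : Set P) := pow_le_pow_right₀ hr h1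
        _ ≤ _ := le_mul_of_one_le_left (by positivity) (by exact_mod_cast h2)
    · rw [pathWeight_of_nonempty h0]
      calc r * (∑ y ∈ upper B x, pathWeight r B y) * r ^ π.length
          = ∑ y ∈ upper B x, pathWeight r B y * r ^ (π ++ [x]).length := by
            rw [Finset.mul_sum, Finset.sum_mul]
            refine Finset.sum_congr rfl fun y _ => ?_
            simp only [List.length_append, List.length_singleton, pow_succ]
            ring
        _ ≤ ∑ y ∈ upper B x, extensions B (π ++ [x] ++ [y]) * r ^ len (B : Set P) :=
            Finset.sum_le_sum fun y hy => ih y hy _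
              (append_mem_paths h (mem_upper.1 hy).2 (mem_upper.1 hy).1)
        _ ≤ _ := by
            rw [← Finset.sum_mul]
            exact mul_le_mul_of_nonneg_right (by exact_mod_cast sum_extensions_le _ _)
              (by positivity)

theorem sum_pathWeight_le (hr : 1 ≤ r) : ∑ x ∈ front B ∅, pathWeight r B x ≤
    (maxPaths (B : Set P)).ncard * r ^ len (B : Set P) := by
  calc ∑ x ∈ front B ∅, pathWeight r B x
      ≤ ∑ x ∈ front B ∅, extensions B ([] ++ [x]) * r ^ len (B : Set P) := by
        refine Finset.sum_le_sum fun x hx => ?_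
        obtain ⟨h1, -, h2⟩ := mem_front.1 hx
        have h3 : [] ++ [x] ∈ paths (B : Set P) := by
          refine ⟨by simp, ?_, by simpa using h1⟩
          simpa [isMin_iff_forall_not_lt] using h2
        simpa using pathWeight_mul_le hr [] x h3
    _ ≤ extensions B [] * r ^ len (B : Set P) := by
        rw [← Finset.sum_mul]
        exact mul_le_mul_of_nonneg_right (by exact_mod_cast sum_extensions_le _ _) (by positivity)
    _ = _ := by
        simp [extensions, Set.ncard_eq_toFinset_card _ (finite_maxPaths B.finite_toSet)]

open Classical in
/-- The weight of a state: the total weight of the sequences that start at its growth elements. -/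
def stateWeight (r : ℝ) (B : Finset P) (S : Set P) : ℝ :=
  if (B : Set P) ⊆ S then 1 else ∑ x ∈ front B S, pathWeight r B x

theorem stateWeight_pos (hr : 1 ≤ r) (hB : IsLowerSet (B : Set P)) (S : Set P) :
    0 < stateWeight r B S := by
  rw [stateWeight]
  split_ifs with h
  · exact one_pos
  · exact Finset.sum_pos (fun x _ => by linarith [le_pathWeight (B := B) hr x])
      (front_nonempty hB h)

/-- An element that becomes a growth element when `x` is added must cover `x`. By the recursion for
`pathWeight` such elements weigh at most `r⁻¹` times as much as `x` in total, so the rest of the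
weight of `x` is lost. -/
theorem stateWeight_insert_le (hr : 1 ≤ r) {S : Set P} (hS : IsLowerSet S) (hx : x ∈ front B S) :
    stateWeight r B (insert x S) ≤
      stateWeight r B S - (1 - r⁻¹) * pathWeight r B x := by
  classical
  have hw : ∀ z, 0 ≤ pathWeight r B z := fun z => by linarith [le_pathWeight (B := B) hr z]
  have hxS := (mem_front.1 hx).2.1
  have h : ¬ (B : Set P) ⊆ S := fun h => hxS (h (mem_front.1 hx).1)
  have hr0 : 0 < r := by linarith
  rw [stateWeight, stateWeight, if_neg h, ← Finset.add_sum_erase _ _ hx]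
  split_ifs with h'
  -- Covered states have weight `1` instead of an empty sum, to keep the logarithm meaningful. The
  -- bound survives because `pathWeight` is at least `r`.
  · have h1 : 1 ≤ r⁻¹ * pathWeight r B x := by
      rw [← div_eq_inv_mul, le_div_iff₀ hr0, one_mul]
      exact le_pathWeight hr x
    have h2 := Finset.sum_nonneg (s := (front B S).erase x) fun z _ => hw z
    linarith
  · have h1 : ∑ y ∈ upper B x, pathWeight r B y ≤ r⁻¹ * pathWeight r B x := by
      rcases (upper B x).eq_empty_or_nonempty with h0 | h0
      · rw [h0, Finset.sum_empty]
        exact mul_nonneg (by positivity) (hw x)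
      · rw [pathWeight_of_nonempty h0, inv_mul_cancel_left₀ hr0.ne']
    have h2 : front B (insert x S) ⊆ (front B S).erase x ∪ upper B x := by
      intro z hz
      obtain ⟨hz1, hz2, hz3⟩ := mem_front.1 hz
      have hzx : z ≠ x := fun h => hz2 (Or.inl h)
      have hzS : z ∉ S := fun h => hz2 (Or.inr h)
      by_cases hlt : x < z
      · refine Finset.mem_union_right _ (mem_upper.2 ⟨hz1, hlt, fun w hxw hwz => ?_⟩)
        rcases hz3 w hwz with rfl | hw
        · exact hxw.false
        · exact hxS (hS hxw.le hw)
      · refine Finset.mem_union_left _ (Finset.mem_erase.2 ⟨hzx, mem_front.2 ⟨hz1, hzS, ?_⟩⟩)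
        intro y hy
        rcases hz3 y hy with rfl | h
        · exact absurd hy hlt
        · exact h
    have h3 : ∑ z ∈ front B (insert x S), pathWeight r B z ≤
        ∑ z ∈ (front B S).erase x, pathWeight r B z + ∑ z ∈ upper B x, pathWeight r B z := by
      refine (Finset.sum_le_sum_of_subset_of_nonneg h2 fun z _ _ => hw z).trans ?_
      rw [← Finset.sum_union_inter]
      exact le_add_of_nonneg_right (Finset.sum_nonneg fun z _ => hw z)
    linarith

/-- An upper bound on the mean covering time, by the exponential moment method. -/
theorem meanTime_le {lam : P → ℝ} {c : ℝ} (hc : 0 < c) (hlam : ∀ x, c ≤ lam x)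
    (hB : IsLowerSet (B : Set P)) {u : ℝ} (hu0 : 0 < u) (hu1 : u < 1) :
    meanTime lam B ∅ ≤ 1 / c * (width (B : Set P) / u + len (B : Set P) / (1 - u)) := by
  have hlam' : ∀ x, 0 < lam x := fun x => hc.trans_le (hlam x)
  have h1u : 0 < 1 - u := by linarith
  -- With this `r`, the lost fraction `1 - r⁻¹` is `u`.
  set r := (1 - u)⁻¹ with hr
  have hr1 : 1 ≤ r := (one_le_inv₀ h1u).2 (by linarith)
  have hri : 1 - r⁻¹ = u := by rw [hr, inv_inv]; ring
  have hpos := stateWeight_pos (B := B) hr1 hB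
  have key : meanTime lam B ∅ - 1 / (c * u) * Real.log (stateWeight r B ∅) ≤ 0 := by
    refine nonpos_of_drift_nonneg
      (u := fun S => meanTime lam B S - 1 / (c * u) * Real.log (stateWeight r B S)) hlam' hB
      (fun S hS => ?_) (fun S hS hBS => ?_) isLowerSet_empty
    · simp [meanTime, expect_of_subset hS, stateWeight, if_pos hS]
    · have e1 : drift lam B (meanTime lam B) S = -1 := drift_expect hlam' hB hBS
      -- As `log y ≤ y - 1`, the jump at `x` lowers the logarithm by at least `u` times the share of
      -- `x` in the weight of the state. The shares add up to `1` and the rates are at least `c`.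
      have e2 : ∑ x ∈ front B S, lam x *
          (Real.log (stateWeight r B (insert x S)) - Real.log (stateWeight r B S)) ≤ - (c * u) := by
        calc _ ≤ ∑ x ∈ front B S, - (c * u / stateWeight r B S) * pathWeight r B x := by
              refine Finset.sum_le_sum fun x hx => ?_
              have h1 := stateWeight_insert_le hr1 hS hx
              rw [hri] at h1
              have h2 := Real.log_le_sub_one_of_pos (div_pos (hpos (insert x S)) (hpos S))
              rw [Real.log_div (hpos _).ne' (hpos _).ne'] at h2
              have hw : 0 ≤ pathWeight r B x := by linarith [le_pathWeight (B := B) hr1 x]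
              have h3 : stateWeight r B (insert x S) / stateWeight r B S - 1 ≤
                  - (u * pathWeight r B x / stateWeight r B S) := by
                rw [sub_le_iff_le_add, div_le_iff₀ (hpos S), add_mul, neg_mul,
                  div_mul_cancel₀ _ (hpos S).ne']
                linarith
              have h4 : 0 ≤ u * pathWeight r B x / stateWeight r B S :=
                div_nonneg (mul_nonneg hu0.le hw) (hpos S).le
              calc _ ≤ lam x * - (u * pathWeight r B x / stateWeight r B S) :=
                    mul_le_mul_of_nonneg_left (h2.trans h3) (hlam' x).le
                _ ≤ c * - (u * pathWeight r B x / stateWeight r B S) := by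
                    nlinarith [hlam x]
                _ = _ := by ring
          _ = _ := by
              rw [← Finset.mul_sum, neg_mul]
              have : ∑ x ∈ front B S, pathWeight r B x = stateWeight r B S := by
                rw [stateWeight, if_neg hBS]
              rw [this, div_mul_cancel₀ _ (hpos S).ne']
      have hcu : 0 < c * u := mul_pos hc hu0
      have e3 : 1 / (c * u) * ∑ x ∈ front B S, lam x *
          (Real.log (stateWeight r B (insert x S)) - Real.log (stateWeight r B S)) ≤ -1 := by
        calc _ ≤ 1 / (c * u) * (- (c * u)) := mul_le_mul_of_nonneg_left e2 (by positivity)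
          _ = -1 := by field_simp
      rw [Finset.mul_sum] at e3
      simp only [drift] at e1 ⊢
      rw [← sub_nonneg, ← e1, ← Finset.sum_sub_distrib] at e3
      refine e3.trans_eq (Finset.sum_congr rfl fun x _ => ?_)
      ring
  have hN : (1 : ℝ) ≤ (maxPaths (B : Set P)).ncard := by
    exact_mod_cast (Set.ncard_pos (finite_maxPaths B.finite_toSet)).2
      (maxPaths_nonempty B.finite_toSet)
  have hF : stateWeight r B ∅ ≤ (maxPaths (B : Set P)).ncard * r ^ len (B : Set P) := by
    rw [stateWeight]
    split_ifs with h
    · exact one_le_mul_of_one_le_of_one_le hN (one_le_pow₀ hr1)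
    · exact sum_pathWeight_le hr1
  have hlog : Real.log (stateWeight r B ∅) ≤ width (B : Set P) + len (B : Set P) * (r - 1) := by
    calc _ ≤ Real.log ((maxPaths (B : Set P)).ncard * r ^ len (B : Set P)) :=
          Real.log_le_log (hpos _) hF
      _ = width (B : Set P) + len (B : Set P) * Real.log r := by
          rw [Real.log_mul (by linarith) (by positivity), Real.log_pow, width]
      _ ≤ _ := by
          gcongr
          exact Real.log_le_sub_one_of_pos (by positivity)
  have hr2 : r - 1 = u / (1 - u) := by rw [hr]; field_simp; ring
  rw [hr2] at hlog
  calc meanTime lam B ∅ ≤ 1 / (c * u) * Real.log (stateWeight r B ∅) := by linarith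
    _ ≤ 1 / (c * u) * (width (B : Set P) + len (B : Set P) * (u / (1 - u))) :=
        mul_le_mul_of_nonneg_left hlog (by positivity)
    _ = _ := by field_simp

end Paths

end CrystalGrowth

end

noncomputable section

namespace CrystalGrowth

/-! ### Steadiness and the number of maximal paths. -/

section Counting

variable {P : Type*} [PartialOrder P] {B : Finset P} {A : Set P}

theorem exists_covBy (hfin : ∀ a : P, (Set.Iic a).Finite) {x : P} (hx : ¬ IsMin x) :
    ∃ y, y ⋖ x := by
  obtain ⟨y, hy⟩ := not_isMin_iff.1 hx
  obtain ⟨m, hm⟩ := ((hfin x).subset (Set.Iio_subset_Iic_self)).exists_maximal ⟨y, hy⟩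
  exact ⟨m, hm.1, fun z hmz hzx => hmz.not_ge (hm.2 hzx hmz.le)⟩

theorem exists_path (hfin : ∀ a : P, (Set.Iic a).Finite) (x : P) :
    ∃ π, π ++ [x] ∈ paths (Set.univ : Set P) := by
  induction hn : (Set.Iic x).ncard using Nat.strong_induction_on generalizing x with
  | _ n ih =>
    subst hn
    by_cases hx : IsMin x
    · exact ⟨[], by simp [paths, hx]⟩
    · obtain ⟨y, hy⟩ := exists_covBy hfin hx
      obtain ⟨π, hπ⟩ := ih _ (Set.ncard_lt_ncard
        ((Set.ssubset_iff_of_subset (Set.Iic_subset_Iic.2 hy.le)).2 ⟨x, le_rfl, hy.lt.not_ge⟩)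
        (hfin x)) y rfl
      exact ⟨π ++ [y], append_mem_paths hπ hy trivial⟩

theorem le_last_of_mem_path {π : List P} {x : P} (h : π ++ [x] ∈ paths A) :
    ∀ y ∈ π ++ [x], y ≤ x := by
  have h1 : (π ++ [x]).IsChain (· < ·) := h.1.imp fun _ _ h => h.lt
  have h2 := List.isChain_iff_pairwise.1 h1
  intro y hy
  rcases List.mem_append.1 hy with hy | hy
  · exact ((List.pairwise_append.1 h2).2.2 y hy x (by simp)).le
  · exact (List.mem_singleton.1 hy).le

/-- Nothing in `Set.Iic x` lies above `x`. Steadiness therefore applies to any path that ends at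
`x`, whatever set it was taken in. -/
theorem maximal_of_path {π : List P} {x : P} (h : π ++ [x] ∈ paths A) :
    π ++ [x] ∈ maxPaths (Set.Iic x) := by
  refine ⟨⟨h.1, h.2.1, le_last_of_mem_path h⟩, ?_⟩
  rintro ξ hξ ⟨t, rfl⟩
  cases t with
  | nil => simp
  | cons y t =>
    have h1 := (List.isChain_append.1 hξ.1).2.2 x (by simp) y (by simp)
    exact absurd (hξ.2.2 y (by simp)) h1.lt.not_ge

/-- Under steadiness, the lengths of the paths are controlled by the length of any path to an upper
bound of their elements. -/
theorem length_le_of_steady {C : ℝ} (hfin : ∀ a : P, (Set.Iic a).Finite)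
    (hC : ∀ x : P, ∀ π ∈ maxPaths (Set.Iic x), ∀ ξ ∈ maxPaths (Set.Iic x),
      (π.length : ℝ) ≤ C * (ξ.length : ℝ)) {π ρ : List P} {x z : P} {A' : Set P}
    (hπ : π ++ [x] ∈ paths A) (hρ : ρ ++ [z] ∈ paths A') (hxz : x ≤ z) :
    ((π ++ [x]).length : ℝ) ≤ C * (ρ ++ [z]).length := by
  obtain ⟨ξ, hξ, hp⟩ := exists_maxPaths (A := Set.Iic z) (hfin z) (π := π ++ [x])
    ⟨hπ.1, hπ.2.1, fun y hy => (le_last_of_mem_path hπ y hy).trans hxz⟩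
  exact (Nat.cast_le.2 hp.length_le).trans (hC z ξ hξ _ (maximal_of_path hρ))

/-- There are at most `D` choices at each of the at most `len B - (π.length + 1)` remaining steps.
The multiplied form avoids truncated subtraction. -/
theorem extensions_mul_le {D : ℕ} (hD : 0 < D) (hup : ∀ x, (upper B x).card ≤ D)
    (π : List P) (x : P) (h : π ++ [x] ∈ paths (B : Set P)) :
    extensions B (π ++ [x]) * D ^ (π.length + 1) ≤ D ^ len (B : Set P) := by
  classical
  induction x using upper_induction B generalizing π with
  | h x ih =>
    have hsub : ∀ ξ ∈ paths (B : Set P), π ++ [x] <+: ξ → ξ = π ++ [x] ∨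
        ∃ y ∈ upper B x, π ++ [x] ++ [y] <+: ξ := by
      rintro ξ hξ ⟨t, rfl⟩
      cases t with
      | nil => simp
      | cons y t =>
        refine Or.inr ⟨y, mem_upper.2 ⟨hξ.2.2 y (by simp), ?_⟩, t, by simp⟩
        exact (List.isChain_append.1 hξ.1).2.2 x (by simp) y (by simp)
    rcases (upper B x).eq_empty_or_nonempty with h0 | h0
    · have h1 : extensions B (π ++ [x]) ≤ 1 := by
        refine Finset.card_le_one_iff_subset_singleton.2 ⟨π ++ [x], fun ξ hξ => ?_⟩
        simp only [Finset.mem_filter, Set.Finite.mem_toFinset] at hξ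
        rcases hsub ξ hξ.1.1 hξ.2 with h | ⟨y, hy, -⟩
        · simpa using h
        · simp [h0] at hy
      have h2 : π.length + 1 ≤ len (B : Set P) := by
        simpa using length_le_len B.finite_toSet h
      calc _ ≤ 1 * D ^ (π.length + 1) := Nat.mul_le_mul_right _ h1
        _ = D ^ (π.length + 1) := one_mul _
        _ ≤ _ := Nat.pow_le_pow_right hD h2
    · have h1 : extensions B (π ++ [x]) ≤ ∑ y ∈ upper B x, extensions B (π ++ [x] ++ [y]) := by
        refine (Finset.card_le_card fun ξ hξ => ?_).trans Finset.card_biUnion_le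
        simp only [Finset.mem_filter, Set.Finite.mem_toFinset, Finset.mem_biUnion] at hξ ⊢
        rcases hsub ξ hξ.1.1 hξ.2 with rfl | ⟨y, hy, hp⟩
        · obtain ⟨y, hy⟩ := h0
          have h2 := hξ.1.2 _ (append_mem_paths h (mem_upper.1 hy).2 (mem_upper.1 hy).1)
            (List.prefix_append _ _)
          simp at h2
        · exact ⟨y, hy, hξ.1, hp⟩
      refine Nat.le_of_mul_le_mul_right ?_ hD
      calc extensions B (π ++ [x]) * D ^ (π.length + 1) * D
          ≤ (∑ y ∈ upper B x, extensions B (π ++ [x] ++ [y])) * D ^ (π.length + 1) * D := by gcongr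
        _ = ∑ y ∈ upper B x, extensions B (π ++ [x] ++ [y]) * D ^ ((π ++ [x]).length + 1) := by
            rw [Finset.sum_mul, Finset.sum_mul]
            refine Finset.sum_congr rfl fun y _ => ?_
            simp only [List.length_append, List.length_singleton, pow_succ]
            ring
        _ ≤ ∑ y ∈ upper B x, D ^ len (B : Set P) := Finset.sum_le_sum fun y hy =>
            ih y hy _ (append_mem_paths h (mem_upper.1 hy).2 (mem_upper.1 hy).1)
        _ ≤ D ^ len (B : Set P) * D := by
            rw [Finset.sum_const, smul_eq_mul, mul_comm]
            exact Nat.mul_le_mul_left _ (hup x)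

/-- With a single minimal element all maximal paths extend `[o]`, so the branching bound counts them
all. Linear growth of the length thus entails linear growth of the width. -/
theorem width_le {D : ℕ} (hD : 0 < D) (hup : ∀ x, (upper B x).card ≤ D) {o : P} (ho : o ∈ B)
    (hmin : ∀ x : P, IsMin x ↔ x = o) : width (B : Set P) ≤ len (B : Set P) * Real.log D := by
  classical
  have ho' : [] ++ [o] ∈ paths (B : Set P) := by simp [paths, hmin, ho]
  have h1 : (maxPaths (B : Set P)).ncard ≤ extensions B ([] ++ [o]) := by
    rw [Set.ncard_eq_toFinset_card _ (finite_maxPaths B.finite_toSet)]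
    refine Finset.card_le_card fun ξ hξ => ?_
    rw [Set.Finite.mem_toFinset] at hξ
    simp only [Finset.mem_filter, Set.Finite.mem_toFinset, hξ, true_and]
    cases ξ with
    | nil => simpa using hξ.2 _ ho' (List.nil_prefix)
    | cons y t =>
      have : y = o := (hmin y).1 (hξ.1.2.1 y (by simp))
      simp [this]
  have h2 := extensions_mul_le hD hup [] o ho'
  have h3 : (maxPaths (B : Set P)).ncard ≤ D ^ len (B : Set P) :=
    (h1.trans (Nat.le_mul_of_pos_right _ (by positivity))).trans h2
  have h4 := (Set.ncard_pos (finite_maxPaths B.finite_toSet)).2 (maxPaths_nonempty B.finite_toSet)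
  rw [width, ← Real.log_pow]
  exact Real.log_le_log (by exact_mod_cast h4) (by exact_mod_cast h3)

end Counting

/-! ### Translations in the cone, powers of lower sets, gluing of paths. -/

section Cone

variable {G : Type*} [Group G] [PartialOrder G] [MulLeftMono G]

theorem Cone.one_le (x : Cone G) : 1 ≤ x := x.2

theorem Cone.mul_le_mul_left_iff {a x y : Cone G} : a * x ≤ a * y ↔ x ≤ y := by
  simp [← Subtype.coe_le_coe]

theorem Cone.mul_lt_mul_left_iff {a x y : Cone G} : a * x < a * y ↔ x < y := by
  simp [lt_iff_le_not_ge, Cone.mul_le_mul_left_iff]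

theorem Cone.mul_le_mul [MulRightMono G] {a b x y : Cone G} (h : a ≤ b) (h' : x ≤ y) :
    a * x ≤ b * y :=
  mul_le_mul' (α := G) h h'

theorem Cone.isMin_iff {x : Cone G} : IsMin x ↔ x = 1 :=
  ⟨fun h => le_antisymm (h (Cone.one_le x)) (Cone.one_le x),
    fun h => h ▸ fun y _ => Cone.one_le y⟩

theorem Cone.exists_eq_mul_of_le {x y : Cone G} (h : x ≤ y) : ∃ z : Cone G, y = x * z :=
  ⟨⟨(x : G)⁻¹ * y, le_inv_mul_iff_mul_le.2 (by simpa using h)⟩, by ext; simp⟩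

/-- Left translation by `a` is an order isomorphism of the cone onto the elements above `a`, so
anything between two translates is itself a translate. -/
theorem Cone.mul_covBy_mul_iff {a x y : Cone G} : a * x ⋖ a * y ↔ x ⋖ y := by
  refine ⟨fun h => ⟨Cone.mul_lt_mul_left_iff.1 h.1, fun z hxz hzy =>
    h.2 (Cone.mul_lt_mul_left_iff.2 hxz) (Cone.mul_lt_mul_left_iff.2 hzy)⟩, fun h =>
    ⟨Cone.mul_lt_mul_left_iff.2 h.1, fun z hxz hzy => ?_⟩⟩
  obtain ⟨w, rfl⟩ := Cone.exists_eq_mul_of_le hxz.le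
  rw [mul_assoc, Cone.mul_lt_mul_left_iff] at hzy
  rw [mul_assoc, Cone.mul_lt_mul_left_iff] at hxz
  exact h.2 hxz hzy

theorem Cone.card_upper_le (hfin : {b : Cone G | 1 ⋖ b}.Finite) (B : Finset (Cone G))
    (x : Cone G) : (upper B x).card ≤ hfin.toFinset.card := by
  classical
  refine (Finset.card_le_card fun y hy => ?_).trans (Finset.card_image_le (f := fun s => x * s))
  obtain ⟨-, h⟩ := mem_upper.1 hy
  obtain ⟨s, rfl⟩ := Cone.exists_eq_mul_of_le h.le
  refine Finset.mem_image.2 ⟨s, hfin.mem_toFinset.2 ?_, rfl⟩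
  exact Cone.mul_covBy_mul_iff.1 (by simpa using h)

theorem one_mem_of_lower {A : Set (Cone G)} (hA : IsLowerSet A) (hne : A.Nonempty) : 1 ∈ A :=
  let ⟨a, ha⟩ := hne
  hA (Cone.one_le a) ha

section LowerMul

variable {M : Type*} [Monoid M] [PartialOrder M]

theorem isLowerSet_lowerMul (A B : Set M) : IsLowerSet (lowerMul A B) := by
  rintro x y hyx ⟨a, ha, b, hb, h⟩
  exact ⟨a, ha, b, hb, hyx.trans h⟩

theorem finite_lowerMul (hfin : ∀ a : M, (Set.Iic a).Finite) {A B : Set M} (hA : A.Finite)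
    (hB : B.Finite) : (lowerMul A B).Finite := by
  refine (hA.biUnion fun a _ => hB.biUnion fun b _ => hfin (a * b)).subset ?_
  rintro x ⟨a, ha, b, hb, h⟩
  simp only [Set.mem_iUnion]
  exact ⟨a, ha, b, hb, h⟩

theorem mul_mem_lowerMul {A B : Set M} {a b : M} (ha : a ∈ A) (hb : b ∈ B) :
    a * b ∈ lowerMul A B :=
  ⟨a, ha, b, hb, le_rfl⟩

theorem subset_lowerMul {A B : Set M} (hB : 1 ∈ B) : A ⊆ lowerMul A B :=
  fun a ha => ⟨a, ha, 1, hB, by simp⟩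

theorem isLowerSet_lowerPow (A : Set M) (n : ℕ) : IsLowerSet (lowerPow A n) := by
  cases n with
  | zero => exact isLowerSet_Iic 1
  | succ n => exact isLowerSet_lowerMul _ _

theorem finite_lowerPow (hfin : ∀ a : M, (Set.Iic a).Finite) {A : Set M} (hA : A.Finite) (n : ℕ) :
    (lowerPow A n).Finite := by
  induction n with
  | zero => exact hfin 1
  | succ n ih => exact finite_lowerMul hfin hA ih

theorem one_mem_lowerPow {A : Set M} (hA : 1 ∈ A) (n : ℕ) : 1 ∈ lowerPow A n := by
  induction n with
  | zero => exact le_rfl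
  | succ n ih => exact ⟨1, hA, 1, ih, by simp⟩

end LowerMul

theorem lowerPow_add [MulRightMono G] (A : Set (Cone G)) (m n : ℕ) :
    lowerPow A (m + n) = lowerMul (lowerPow A m) (lowerPow A n) := by
  induction m with
  | zero =>
    ext x
    rw [zero_add]
    refine ⟨fun h => ⟨1, le_rfl, x, h, by simp⟩, ?_⟩
    rintro ⟨a, ha, b, hb, h⟩
    refine isLowerSet_lowerPow A n (h.trans ?_) hb
    simpa using Cone.mul_le_mul (show a ≤ 1 from ha) (le_refl b)
  | succ m ih =>
    rw [Nat.succ_add, lowerPow, lowerPow, ih]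
    ext x
    constructor
    · rintro ⟨a, ha, y, ⟨b, hb, c, hc, hy⟩, h⟩
      refine ⟨a * b, mul_mem_lowerMul ha hb, c, hc, h.trans ?_⟩
      rw [mul_assoc]
      exact Cone.mul_le_mul le_rfl hy
    · rintro ⟨y, ⟨a, ha, b, hb, hy⟩, c, hc, h⟩
      refine ⟨a, ha, b * c, mul_mem_lowerMul hb hc, h.trans ?_⟩
      rw [← mul_assoc]
      exact Cone.mul_le_mul hy le_rfl

/-- Translation by the endpoint `a` moves the initial `1` of the second path to `a`, where the first
path already ends. That entry is counted once, whence the `+ 1` in `len_add_le`. -/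
theorem concat_mem_paths {A B C : Set (Cone G)} (hAC : A ⊆ C) {π ξ : List (Cone G)} {a : Cone G}
    (hBC : ∀ b ∈ B, a * b ∈ C) (hπ : π ++ [a] ∈ paths A) (hξ : 1 :: ξ ∈ paths B) :
    π ++ [a] ++ ξ.map (a * ·) ∈ paths C := by
  refine ⟨List.isChain_append.2 ⟨hπ.1, ?_, ?_⟩, ?_, ?_⟩
  · rw [List.isChain_map]
    exact (List.isChain_cons.1 hξ.1).2.imp fun x y h => Cone.mul_covBy_mul_iff.2 h
  · cases ξ with
    | nil => simp
    | cons y t =>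
      have h := (List.isChain_cons.1 hξ.1).1 y (by simp)
      simpa using (Cone.mul_covBy_mul_iff (a := a)).2 h
  · intro x hx
    refine hπ.2.1 x ?_
    cases π <;> simp_all
  · intro x hx
    rcases List.mem_append.1 hx with hx | hx
    · exact hAC (hπ.2.2 x hx)
    · obtain ⟨y, hy, rfl⟩ := List.mem_map.1 hx
      exact hBC y (hξ.2.2 y (by simp [hy]))

theorem exists_eq_cons {A : Set (Cone G)} {ξ : List (Cone G)} (h : ξ ∈ paths A) (h0 : ξ ≠ []) :
    ∃ t, ξ = 1 :: t := by
  cases ξ with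
  | nil => exact absurd rfl h0
  | cons y t => exact ⟨t, by rw [Cone.isMin_iff.1 (h.2.1 y (by simp))]⟩

theorem singleton_one_mem_paths {A : Set (Cone G)} (h : 1 ∈ A) : [1] ∈ paths A := by
  refine ⟨by simp, fun x hx => ?_, fun x hx => ?_⟩
  · cases hx
    exact Cone.isMin_iff.2 rfl
  · rw [List.mem_singleton.1 hx]
    exact h

theorem ne_nil_of_mem_maxPaths {A : Set (Cone G)} (h : 1 ∈ A) {ξ : List (Cone G)}
    (hξ : ξ ∈ maxPaths A) : ξ ≠ [] := by
  rintro rfl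
  simpa using hξ.2 _ (singleton_one_mem_paths h) List.nil_prefix

theorem len_add_le {A B C : Set (Cone G)} (hA : A.Finite) (hB : B.Finite) (hC : C.Finite)
    (h1A : 1 ∈ A) (h1B : 1 ∈ B) (hAB : C = lowerMul A B) : len A + len B ≤ len C + 1 := by
  obtain ⟨π, hπ, hπl⟩ := exists_length_eq_len hA
  obtain ⟨ξ, hξ, hξl⟩ := exists_length_eq_len hB
  have h1 : 1 ≤ len A := by simpa using length_le_len hA (singleton_one_mem_paths h1A)
  have h2 : 1 ≤ len B := by simpa using length_le_len hB (singleton_one_mem_paths h1B)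
  obtain ⟨t, rfl⟩ := exists_eq_cons hξ (by rintro rfl; simp at hξl; omega)
  obtain ⟨ρ, a, rfl⟩ := List.eq_nil_or_concat' π |>.resolve_left (by rintro rfl; simp at hπl; omega)
  have h3 := length_le_len hC (concat_mem_paths (hAB ▸ subset_lowerMul h1B)
    (fun b hb => hAB ▸ mul_mem_lowerMul (hπ.2.2 a (by simp)) hb) hπ hξ)
  simp only [List.length_append, List.length_map, List.length_cons, List.length_nil] at *
  omega

/-- Gluing two maximal paths and extending the result to a maximal path is injective on pairs.
Initial segments of one path are comparable, and comparable maximal paths are equal; this recovers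
the first path and, after cancelling the translation, the second. -/
theorem width_add_le {A B C : Set (Cone G)} (hA : A.Finite) (hB : B.Finite) (hC : C.Finite)
    (h1A : 1 ∈ A) (h1B : 1 ∈ B) (hAB : C = lowerMul A B) : width A + width B ≤ width C := by
  have pos : ∀ {D : Set (Cone G)}, D.Finite → 0 < (maxPaths D).ncard := fun hD =>
    (Set.ncard_pos (finite_maxPaths hD)).2 (maxPaths_nonempty hD)
  -- The default value of `getLastD` plays no role: maximal paths are nonempty here.
  have key : ∀ p : List (Cone G) × List (Cone G), p ∈ maxPaths A ×ˢ maxPaths B →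
      ∃ ζ ∈ maxPaths C, p.1 ++ p.2.tail.map (p.1.getLastD 1 * ·) <+: ζ := by
    rintro ⟨π, ξ⟩ ⟨hπ, hξ⟩
    obtain ⟨t, rfl⟩ := exists_eq_cons hξ.1 (ne_nil_of_mem_maxPaths h1B hξ)
    obtain ⟨ρ, a, rfl⟩ := List.eq_nil_or_concat' π |>.resolve_left (ne_nil_of_mem_maxPaths h1A hπ)
    refine exists_maxPaths hC ?_
    simpa using concat_mem_paths (hAB ▸ subset_lowerMul h1B)
      (fun b hb => hAB ▸ mul_mem_lowerMul (hπ.1.2.2 a (by simp)) hb) hπ.1 hξ.1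
  choose! f hf hfp using key
  have hmax : ∀ {D : Set (Cone G)} {π ρ : List (Cone G)}, π ∈ maxPaths D → ρ ∈ maxPaths D →
      (π <+: ρ ∨ ρ <+: π) → π = ρ := by
    rintro D π ρ h1 h2 (h | h)
    · exact (h1.2 _ h2.1 h).symm
    · exact h2.2 _ h1.1 h
  have hle : (maxPaths A ×ˢ maxPaths B).ncard ≤ (maxPaths C).ncard := by
    refine Set.ncard_le_ncard_of_injOn f hf ?_ (finite_maxPaths hC)
    rintro ⟨π, ξ⟩ ⟨hπ, hξ⟩ ⟨π', ξ'⟩ ⟨hπ', hξ'⟩ he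
    have p1 := hfp (π, ξ) ⟨hπ, hξ⟩
    have p2 := hfp (π', ξ') ⟨hπ', hξ'⟩
    rw [← he] at p2
    dsimp only at p1 p2 hπ hξ hπ' hξ'
    have e1 : π = π' := hmax hπ hπ' (List.prefix_or_prefix_of_prefix
      ((List.prefix_append _ _).trans p1) ((List.prefix_append _ _).trans p2))
    subst e1
    have hinj : Function.Injective fun x => π.getLastD 1 * x := mul_right_injective _
    have e2 := List.prefix_or_prefix_of_prefix p1 p2
    rw [List.prefix_append_right_inj, List.prefix_append_right_inj,
      List.prefix_map_iff_of_injective hinj, List.prefix_map_iff_of_injective hinj] at e2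
    obtain ⟨t, rfl⟩ := exists_eq_cons hξ.1 (ne_nil_of_mem_maxPaths h1B hξ)
    obtain ⟨t', rfl⟩ := exists_eq_cons hξ'.1 (ne_nil_of_mem_maxPaths h1B hξ')
    rw [hmax hξ hξ' (by simpa using e2)]
  rw [Set.ncard_prod] at hle
  rw [width, width, width, ← Real.log_mul (by exact_mod_cast (pos hA).ne')
    (by exact_mod_cast (pos hB).ne')]
  exact Real.log_le_log (by exact_mod_cast Nat.mul_pos (pos hA) (pos hB)) (by exact_mod_cast hle)

/-- The bound `z` is a product of `n` elements of `A`, and the path is glued from paths to the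
factors, each of length at most `len A`. One short path is enough, since steadiness compares all
others with it. -/
theorem exists_short_path [MulRightMono G] (hfin : ∀ a : Cone G, (Set.Iic a).Finite)
    {A : Set (Cone G)} (hA : A.Finite) (hA' : IsLowerSet A) (n : ℕ) :
    ∀ x ∈ lowerPow A n, ∃ z, x ≤ z ∧ ∃ π, π ++ [z] ∈ paths (Set.univ : Set (Cone G)) ∧
      π.length ≤ n * len A := by
  induction n with
  | zero =>
    intro x hx
    exact ⟨1, hx, [], singleton_one_mem_paths trivial, by simp⟩
  | succ n ih =>
    rintro x ⟨a, ha, b, hb, hx⟩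
    obtain ⟨z, hz, π, hπ, hl⟩ := ih b hb
    obtain ⟨ρ, hρ⟩ := exists_path hfin a
    have hρ' : ρ ++ [a] ∈ paths A :=
      ⟨hρ.1, hρ.2.1, fun y hy => hA' (le_last_of_mem_path hρ y hy) ha⟩
    have hρl := length_le_len hA hρ'
    obtain ⟨t, ht⟩ := exists_eq_cons hπ (by simp)
    have h1 := concat_mem_paths (C := Set.univ) (Set.subset_univ _) (fun _ _ => trivial) hρ'
      (ht ▸ hπ)
    refine ⟨a * z, hx.trans (Cone.mul_le_mul le_rfl hz), ?_⟩
    have h2 := congrArg List.length ht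
    simp only [List.length_append, List.length_cons, List.length_nil] at h2 hρl
    -- The path to `z` starts at `1`, an entry absorbed by `a`. If it has no other entry then `z =
    -- 1`; otherwise its last entry survives and is `z`.
    rcases List.eq_nil_or_concat' t with rfl | ⟨s, w, rfl⟩
    · have hz1 : z = 1 := by
        rcases List.append_eq_singleton_iff.1 ht with h | h
        · simpa using h.2
        · simp at h
      refine ⟨ρ, by simpa [hz1] using h1, ?_⟩
      nlinarith
    · have hw : z = w := by
        have h3 := congrArg List.getLast? ht
        rw [← List.cons_append, List.getLast?_concat, List.getLast?_concat] at h3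
        exact Option.some.inj h3
      refine ⟨ρ ++ [a] ++ s.map (a * ·), ?_, ?_⟩
      · subst hw
        simpa using h1
      · simp only [List.length_append, List.length_map, List.length_cons, List.length_nil] at h2 ⊢
        nlinarith

/-- This is where steadiness enters: a nonempty path in `A ^ n` ends below an element that has a
path of length at most `n * len A + 1`, so it is at most `C` times as long. -/
theorem exists_len_lowerPow_le [MulRightMono G] (hfin : ∀ a : Cone G, (Set.Iic a).Finite)
    (hsteady : IsSteady (Cone G)) {A : Set (Cone G)} (hA : A.Finite) (hA' : IsLowerSet A) :
    ∃ K : ℝ, 0 ≤ K ∧ ∀ n : ℕ, (len (lowerPow A n) : ℝ) ≤ K * (n + 1) := by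
  obtain ⟨C, hC1, hC⟩ := hsteady
  refine ⟨C * (len A + 1), by positivity, fun n => ?_⟩
  obtain ⟨π, hπ, hπl⟩ := exists_length_eq_len (finite_lowerPow hfin hA n)
  rw [← hπl]
  rcases List.eq_nil_or_concat' π with rfl | ⟨ρ, x, rfl⟩
  · simp only [List.length_nil, Nat.cast_zero]
    positivity
  · obtain ⟨z, hz, ξ, hξ, hl⟩ := exists_short_path hfin hA hA' n x (hπ.2.2 x (by simp))
    refine (length_le_of_steady hfin hC hπ hξ hz).trans ?_
    rw [mul_assoc]
    refine mul_le_mul_of_nonneg_left ?_ (by linarith)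
    have h1 : (ξ.length : ℝ) ≤ n * len A := by exact_mod_cast hl
    have h2 : (0 : ℝ) ≤ n := n.cast_nonneg
    have h3 : (0 : ℝ) ≤ len A := (len A).cast_nonneg
    simp only [List.length_append, List.length_singleton, Nat.cast_add, Nat.cast_one]
    nlinarith

end Cone

end CrystalGrowth

end

noncomputable section

namespace CrystalGrowth

/-! ### Superadditivity of the mean covering time. -/

section Superadditivity

variable {G : Type*} [Group G] [PartialOrder G] [MulLeftMono G] {lam : Cone G → ℝ}
  {A B C : Finset (Cone G)} {S : Set (Cone G)}

theorem meanTime_inter {P : Type*} [PartialOrder P] {lam : P → ℝ} {B : Finset P}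
    (hlam : ∀ x, 0 < lam x) (hB : IsLowerSet (B : Set P)) (S : Set P) :
    meanTime lam B (S ∩ B) = meanTime lam B S :=
  expect_inter hlam hB (fun _ => rfl) S

/-- The growth in the shifted copy `a B` of `B` is slower than the growth in `B`. -/
theorem meanTime_translate_le [MulRightMono G] (hlam : ∀ x, 0 < lam x) (hanti : Antitone lam)
    (hB : IsLowerSet (B : Set (Cone G))) (hC : IsLowerSet (C : Set (Cone G))) {a : Cone G}
    (haB : ∀ b ∈ B, a * b ∈ C) (hS : IsLowerSet S) :
    meanTime lam B {y | a * y ∈ S} ≤ meanTime lam C S := by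
  classical
  suffices meanTime lam B {y | a * y ∈ S} - meanTime lam C S ≤ 0 by linarith
  refine nonpos_of_drift_nonneg
    (u := fun S => meanTime lam B {y | a * y ∈ S} - meanTime lam C S) hlam hC
    (fun S hCS => ?_) (fun S hS hCS => ?_) hS
  · rw [meanTime, meanTime, expect_of_subset hCS,
      expect_of_subset (S := {y | a * y ∈ S}) fun b hb => hCS (haB b hb), sub_zero]
  set T := {y | a * y ∈ S} with hT
  set m := meanTime lam B with hm
  have e1 : drift lam C (meanTime lam C) S = -1 := drift_expect hlam hC hCS
  have hneg : ∀ S' : Set (Cone G), S ⊆ S' → m {y | a * y ∈ S'} - m T ≤ 0 := fun S' h =>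
    sub_nonpos.2 (meanTime_antitone hlam hB fun y hy => h hy)
  have hins : ∀ β, {y | a * y ∈ insert (a * β) S} = insert β T := fun β => by
    ext y
    simp [hT]
  -- A growth element of `S` that lies in `a B` is the translate of a growth element of `T`. Any
  -- other jump leaves `T ∩ B` unchanged.
  have hloc : ∀ α ∈ front C S, α ∉ (front B T).image (a * ·) →
      m {y | a * y ∈ insert α S} - m T = 0 := by
    intro α hα hαI
    obtain ⟨-, h2, h3⟩ := mem_front.1 hα
    rw [sub_eq_zero, hm, ← meanTime_inter hlam hB, ← meanTime_inter hlam hB T]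
    congr 1
    ext y
    simp only [Set.mem_inter_iff, Set.mem_ofPred_eq, Set.mem_insert_iff, hT]
    refine ⟨?_, fun h => ⟨Or.inr h.1, h.2⟩⟩
    rintro ⟨rfl | h, hy⟩
    · refine absurd (Finset.mem_image.2 ⟨y, mem_front.2 ⟨hy, h2, fun z hz => ?_⟩, rfl⟩) hαI
      exact h3 _ (Cone.mul_lt_mul_left_iff.2 hz)
    · exact ⟨h, hy⟩
  -- All differences of `m` are nonpositive. Passing from the rate at `β` to the smaller one at `a *
  -- β`, and dropping the translates still blocked in `S` by elements not above `a`, can only raise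
  -- the sum.
  have e2 : -1 ≤ ∑ α ∈ front C S, lam α * (m {y | a * y ∈ insert α S} - m T) := by
    calc -1 ≤ ∑ β ∈ front B T, lam β * (m (insert β T) - m T) := by
          by_cases h : (B : Set (Cone G)) ⊆ T
          · rw [Finset.sum_eq_zero]
            · norm_num
            · intro β hβ
              exact absurd (h (mem_front.1 hβ).1) (mem_front.1 hβ).2.1
          · exact (drift_expect (q := fun _ => 1) hlam hB h).ge
      _ ≤ ∑ β ∈ front B T, lam (a * β) * (m {y | a * y ∈ insert (a * β) S} - m T) := by
          refine Finset.sum_le_sum fun β _ => ?_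
          have h1 := hneg _ (Set.subset_insert (a * β) S)
          have h2 : lam (a * β) ≤ lam β := hanti (by
            simpa using Cone.mul_le_mul (Cone.one_le a) (le_refl β))
          rw [hins] at h1 ⊢
          nlinarith
      _ = ∑ α ∈ (front B T).image (a * ·), lam α * (m {y | a * y ∈ insert α S} - m T) := by
          rw [Finset.sum_image fun x _ y _ h => mul_left_cancel h]
      _ ≤ ∑ α ∈ front C S ∩ (front B T).image (a * ·),
            lam α * (m {y | a * y ∈ insert α S} - m T) := by
          rw [← neg_le_neg_iff, ← Finset.sum_neg_distrib, ← Finset.sum_neg_distrib]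
          refine Finset.sum_le_sum_of_subset_of_nonneg Finset.inter_subset_right fun α _ _ => ?_
          have h1 := hneg _ (Set.subset_insert α S)
          nlinarith [hlam α]
      _ = _ := by
          refine Finset.sum_subset Finset.inter_subset_left fun α h1 h2 => ?_
          rw [hloc α h1 fun h => h2 (Finset.mem_inter.2 ⟨h1, h⟩), mul_zero]
  have e3 : drift lam C (fun S => m {y | a * y ∈ S} - meanTime lam C S) S =
      ∑ α ∈ front C S, lam α * (m {y | a * y ∈ insert α S} - m T) -
        drift lam C (meanTime lam C) S := by
    rw [drift, drift, ← Finset.sum_sub_distrib]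
    exact Finset.sum_congr rfl fun α _ => by ring
  rw [e3, e1]
  linarith

/-- Jumps outside `A` do not affect `meanTime lam A`, so its drift under the growth in `C` is `-1`
until `A` is covered. At the jump to `α` that covers `A`, the state has no element strictly above
`α`, so `meanTime_translate_le` for the translate `α B` leaves at least the mean time for `B` from
`{1}`. -/
theorem meanTime_add_le_of_not_subset [MulRightMono G] (hlam : ∀ x, 0 < lam x)
    (hanti : Antitone lam)
    (hA : IsLowerSet (A : Set (Cone G))) (hB : IsLowerSet (B : Set (Cone G)))
    (hC : IsLowerSet (C : Set (Cone G))) (hAC : A ⊆ C) (hABC : ∀ a ∈ A, ∀ b ∈ B, a * b ∈ C)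
    (hS : IsLowerSet S) (hAS : ¬ (A : Set (Cone G)) ⊆ S) :
    meanTime lam A S + meanTime lam B {1} ≤ meanTime lam C S := by
  classical
  induction S using front_induction C with
  | h S ih =>
  have hCS : ¬ (C : Set (Cone G)) ⊆ S := fun h => hAS (fun x hx => h (hAC hx))
  have e1 := rate_mul_meanTime hlam hC hCS
  have e2 : drift lam A (meanTime lam A) S = -1 := drift_expect hlam hA hAS
  set mA := meanTime lam A with hmA
  set mC := meanTime lam C with hmC
  set c := meanTime lam B {1} with hc
  have h1 : ∀ α ∈ front C S, mA (insert α S) + c ≤ mC (insert α S) := by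
    intro α hα
    have hl := isLowerSet_insert hS hα
    by_cases h : (A : Set (Cone G)) ⊆ insert α S
    · have hαA : α ∈ A := by
        by_contra hαA
        refine hAS fun x hx => (h hx).resolve_left ?_
        rintro rfl
        exact hαA hx
      have h2 := meanTime_translate_le hlam hanti hB hC (hABC α hαA) hl
      have h3 : {y | α * y ∈ insert α S} = {1} := by
        ext y
        simp only [Set.mem_ofPred_eq, Set.mem_insert_iff, Set.mem_singleton_iff, mul_eq_left]
        refine or_iff_left fun h => (mem_front.1 hα).2.1 (hS ?_ h)
        simpa using (Cone.mul_le_mul_left_iff (a := α)).2 (Cone.one_le y)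
      rw [h3] at h2
      rw [hmA, meanTime, expect_of_subset h, zero_add]
      exact h2
    · exact ih α hα hl h
  have h2 : ∑ α ∈ front C S, lam α * mA (insert α S) =
      -1 + (∑ α ∈ front C S, lam α) * mA S := by
    rw [← e2, Finset.sum_mul, drift, ← sub_eq_iff_eq_add, ← Finset.sum_sub_distrib]
    symm
    have hsub : front A S ⊆ front C S := fun α hα => by
      rw [mem_front] at hα ⊢
      exact ⟨hAC hα.1, hα.2⟩
    rw [← Finset.sum_subset hsub]
    · exact Finset.sum_congr rfl fun α _ => by ring
    · intro α hα hαA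
      have hα' : α ∉ A := fun h => hαA (mem_front.2 ⟨h, (mem_front.1 hα).2⟩)
      rw [hmA, ← meanTime_inter hlam hA, Set.insert_inter_of_notMem (by simpa using hα'),
        meanTime_inter hlam hA, sub_self]
  have h3 : ∑ α ∈ front C S, lam α * (mA (insert α S) + c) ≤
      ∑ α ∈ front C S, lam α * mC (insert α S) :=
    Finset.sum_le_sum fun α hα => mul_le_mul_of_nonneg_left (h1 α hα) (hlam α).le
  simp only [mul_add, Finset.sum_add_distrib, ← Finset.sum_mul] at h3
  refine le_of_mul_le_mul_left ?_ (rate_pos hlam hC hCS)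
  rw [e1]
  linarith

/-- The first jump must add `1`. The resulting constant is the defect of superadditivity. -/
theorem meanTime_empty (hlam : ∀ x, 0 < lam x) (hB : IsLowerSet (B : Set (Cone G)))
    (h1 : 1 ∈ B) : meanTime lam B ∅ = 1 / lam 1 + meanTime lam B {1} := by
  have h2 : front B ∅ = {1} := by
    ext x
    simp only [mem_front, Set.mem_empty_iff_false, not_false_eq_true, true_and,
      Finset.mem_singleton]
    constructor
    · rintro ⟨-, h⟩
      exact Cone.isMin_iff.1 (isMin_iff_forall_not_lt.2 h)
    · rintro rfl
      exact ⟨h1, isMin_iff_forall_not_lt.1 (Cone.isMin_iff.2 rfl)⟩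
  have h3 := rate_mul_meanTime (S := ∅) hlam hB fun h => h h1
  rw [h2, Finset.sum_singleton, Finset.sum_singleton, insert_empty_eq] at h3
  have := hlam 1
  field_simp
  linarith

/-- The mean covering time is superadditive, up to a constant. -/
theorem meanTime_add_le [MulRightMono G] (hlam : ∀ x, 0 < lam x) (hanti : Antitone lam)
    (hA : IsLowerSet (A : Set (Cone G))) (hB : IsLowerSet (B : Set (Cone G)))
    (hC : (C : Set (Cone G)) = lowerMul A B) (h1A : 1 ∈ A) (h1B : 1 ∈ B) :
    meanTime lam A ∅ + meanTime lam B ∅ ≤ meanTime lam C ∅ + 1 / lam 1 := by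
  have hABC : ∀ a ∈ A, ∀ b ∈ B, a * b ∈ C := fun a ha b hb => by
    rw [← Finset.mem_coe, hC]
    exact mul_mem_lowerMul ha hb
  have h := meanTime_add_le_of_not_subset (S := ∅) hlam hanti hA hB
    (hC ▸ isLowerSet_lowerMul _ _)
    (fun a ha => by simpa using hABC a ha 1 h1B) hABC isLowerSet_empty fun h => h h1A
  rw [meanTime_empty hlam hB h1B]
  linarith

end Superadditivity

end CrystalGrowth

end

noncomputable section

namespace CrystalGrowth

/-! ### Extension of the martingale property to local functions. -/

section Dynamics

variable {P : Type*} [PartialOrder P]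

/-- A growth element is minimal in `P` or covers an element of `A`. Finiteness makes the `finsum` in
`generator` a genuine sum, not the default value `0`. -/
theorem finite_growthElements (hfin : IsLocallyFinite P) (A : FinLowerSet P) :
    (growthElements A).Finite := by
  refine (hfin.2.1.union (A.finite.biUnion fun a _ => hfin.2.2 a)).subset fun x hx => ?_
  by_cases h : IsMin x
  · exact Or.inl h
  · obtain ⟨y, hy⟩ := exists_covBy hfin.1 h
    refine Or.inr (Set.mem_biUnion (x := y) ?_ hy)
    by_contra hyA
    exact hy.lt.not_ge (hx.2 hyA hy.le)

/-- The elements that can be reached from the minimal ones in fewer than `k` steps. -/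
def level (P : Type*) [PartialOrder P] : ℕ → Set P
  | 0 => ∅
  | k + 1 => level P k ∪ ({x | IsMin x} ∪ ⋃ a ∈ level P k, {b | a ⋖ b})

theorem finite_level (hfin : IsLocallyFinite P) (k : ℕ) : (level P k).Finite := by
  induction k with
  | zero => exact Set.finite_empty
  | succ k ih => exact ih.union (hfin.2.1.union (ih.biUnion fun a _ => hfin.2.2 a))

theorem monotone_level : Monotone (level P) :=
  monotone_nat_of_le_succ fun _ => Set.subset_union_left

theorem exists_mem_level (hfin : IsLocallyFinite P) (x : P) : ∃ k, x ∈ level P k := by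
  induction hn : (Set.Iic x).ncard using Nat.strong_induction_on generalizing x with
  | _ n ih =>
    subst hn
    by_cases hx : IsMin x
    · exact ⟨1, Or.inr (Or.inl hx)⟩
    · obtain ⟨y, hy⟩ := exists_covBy hfin.1 hx
      obtain ⟨k, hk⟩ := ih _ (Set.ncard_lt_ncard
        ((Set.ssubset_iff_of_subset (Set.Iic_subset_Iic.2 hy.le)).2 ⟨x, le_rfl, hy.lt.not_ge⟩)
        (hfin.1 x)) y rfl
      exact ⟨k + 1, Or.inr (Or.inr (Set.mem_biUnion hk hy))⟩

theorem eventually_subset_level (hfin : IsLocallyFinite P) {S : Set P} (hS : S.Finite) :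
    ∀ᶠ k in atTop, S ⊆ level P k := by
  refine (hS.eventually_all (p := fun x k => x ∈ level P k)).2 fun x _ => ?_
  obtain ⟨k, hk⟩ := exists_mem_level hfin x
  exact eventually_atTop.2 ⟨k, fun m hm => monotone_level hm hk⟩

open Classical in
/-- The test function that agrees with `f` on the subsets of `D` and vanishes elsewhere. -/
def cutoff (D : Set P) (f : Set P → ℝ) (A : FinLowerSet P) : ℝ :=
  if A.carrier ⊆ D then f A.carrier else 0

theorem finite_support_cutoff {D : Set P} (hD : D.Finite) (f : Set P → ℝ) :
    (Function.support (cutoff D f)).Finite := by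
  refine (hD.finite_subsets.preimage (f := FinLowerSet.carrier)
    fun A _ B _ h => FinLowerSet.ext h).subset fun A hA => ?_
  by_contra h
  exact hA (if_neg h)

theorem exists_abs_le_of_finite_support {α : Type*} {f : α → ℝ} (hf : (Function.support f).Finite) :
    ∃ c, ∀ x, |f x| ≤ c := by
  obtain ⟨c, hc⟩ := (hf.image fun x => |f x|).bddAbove
  refine ⟨max c 0, fun x => ?_⟩
  by_cases h : f x = 0
  · simp [h]
  · exact (hc ⟨x, h, rfl⟩).trans (le_max_left _ _)

theorem exists_abs_le_of_local {P : Type*} {B : Finset P} {f : Set P → ℝ}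
    (hf : ∀ S, f (S ∩ B) = f S) :
    ∃ c, ∀ S, |f S| ≤ c := by
  obtain ⟨c, hc⟩ := (B.finite_toSet.finite_subsets.image fun S => |f S|).bddAbove
  refine ⟨c, fun S => ?_⟩
  rw [← hf S]
  exact hc ⟨S ∩ B, Set.inter_subset_right, rfl⟩

variable {lam : P → ℝ}

theorem generator_carrier (f : Set P → ℝ) (g : FinLowerSet P → ℝ) (hfin : IsLocallyFinite P)
    (A : FinLowerSet P) (hA : ∀ α : growthElements A, g (A.grow α) - g A =
      f (insert α.1 A.carrier) - f A.carrier) : generator lam g A =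
      ∑ α ∈ (finite_growthElements hfin A).toFinset,
        lam α * (f (insert α A.carrier) - f A.carrier) := by
  simp only [generator, hA]
  rw [finsum_set_coe_eq_finsum_mem (growthElements A)
    (f := fun α => lam α * (f (insert α A.carrier) - f A.carrier)),
    finsum_mem_eq_finite_toFinset_sum _ (finite_growthElements hfin A)]

theorem generator_cutoff_one (hfin : IsLocallyFinite P) (D : Set P) (A : FinLowerSet P) :
    generator lam (cutoff D fun _ => 1) A = ∑ α ∈ (finite_growthElements hfin A).toFinset,
      lam α * ((open Classical in if insert α A.carrier ⊆ D then (1 : ℝ) else 0) -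
        (open Classical in if A.carrier ⊆ D then (1 : ℝ) else 0)) :=
  generator_carrier (fun S => open Classical in if S ⊆ D then (1 : ℝ) else 0) _ hfin A
    fun _ => rfl

theorem generator_cutoff_one_nonpos (hlam : ∀ x, 0 < lam x) (hfin : IsLocallyFinite P) (D : Set P)
    (A : FinLowerSet P) : generator lam (cutoff D fun _ => 1) A ≤ 0 := by
  rw [generator_cutoff_one hfin]
  refine Finset.sum_nonpos fun α _ => mul_nonpos_of_nonneg_of_nonpos (hlam α).le ?_
  split_ifs with h1 h2 h2
  · simp
  · exact absurd ((Set.subset_insert _ _).trans h1) h2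
  · simp
  · simp

theorem finite_support_generator_cutoff_one (hfin : IsLocallyFinite P) {D : Set P}
    (hD : D.Finite) : (Function.support (generator lam (cutoff D fun _ => 1))).Finite := by
  refine (finite_support_cutoff hD fun _ => 1).subset fun A hA => ?_
  by_contra h
  have h1 : ¬ A.carrier ⊆ D := fun h1 => h (by simp [cutoff, h1])
  refine hA ?_
  rw [generator_cutoff_one hfin]
  refine Finset.sum_eq_zero fun α _ => ?_
  rw [if_neg h1, if_neg fun h2 => h1 ((Set.subset_insert _ _).trans h2), sub_zero, mul_zero]

/-- A jump that leaves `D` adds an element outside `B`, so it does not change `f`. Truncation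
therefore costs exactly `f` times the generator of the indicator of `D`. -/
theorem generator_cutoff (hfin : IsLocallyFinite P) {D : Set P} {B : Finset P}
    (hBD : (B : Set P) ⊆ D) {f : Set P → ℝ} (hf : ∀ S, f (S ∩ B) = f S) (A : FinLowerSet P) :
    generator lam (cutoff D f) A = cutoff D (drift lam B f) A +
      f A.carrier * generator lam (cutoff D fun _ => 1) A := by
  classical
  have e1 : generator lam (cutoff D f) A = _ :=
    generator_carrier (fun S => if S ⊆ D then f S else 0) _ hfin A fun _ => rfl
  rw [e1, generator_cutoff_one hfin]
  by_cases h : A.carrier ⊆ D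
  · simp only [if_pos h]
    have e2 : cutoff D (drift lam B f) A = ∑ α ∈ (finite_growthElements hfin A).toFinset,
        lam α * (f (insert α A.carrier) - f A.carrier) := by
      rw [cutoff, if_pos h, drift]
      refine Finset.sum_subset (fun α hα => ?_) fun α hα hαB => ?_
      · exact (Set.Finite.mem_toFinset _).2 (Finset.mem_filter.1 hα).2
      · have hα' : α ∉ B := fun h => hαB (Finset.mem_filter.2 ⟨h,
          show α ∈ growthElements A from (Set.Finite.mem_toFinset _).1 hα⟩)
        rw [← hf, Set.insert_inter_of_notMem (by simpa using hα'), hf, sub_self, mul_zero]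
    rw [e2, Finset.mul_sum, ← Finset.sum_add_distrib]
    refine Finset.sum_congr rfl fun α _ => ?_
    by_cases hα : insert α A.carrier ⊆ D
    · simp [hα]
    · have hα' : α ∉ B := fun h' => hα (Set.insert_subset (hBD h') h)
      have e3 : f (insert α A.carrier) = f A.carrier := by
        rw [← hf, Set.insert_inter_of_notMem (by simpa using hα'), hf]
      simp only [if_neg hα, e3]
      ring
  · have hins : ∀ α, ¬ insert α A.carrier ⊆ D := fun α h2 => h ((Set.subset_insert _ _).trans h2)
    simp [cutoff, h, hins]

/-- The time grid that approximates `s` from the right. -/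
def gridTime (n : ℕ) (s : ℝ≥0) : ℝ≥0 := (⌊((n : ℝ≥0) + 1) * s⌋₊ + 1) / ((n : ℝ≥0) + 1)

theorem tendsto_gridTime (s : ℝ≥0) : Tendsto (fun n => gridTime n s) atTop (𝓝[>] s) := by
  have h1 : ∀ n, s < gridTime n s := fun n => by
    rw [gridTime, lt_div_iff₀ (by positivity), mul_comm]
    exact Nat.lt_floor_add_one _
  have h2 : ∀ n : ℕ, gridTime n s ≤ s + 1 / ((n : ℝ≥0) + 1) := fun n => by
    rw [gridTime, add_div]
    gcongr
    rw [div_le_iff₀ (by positivity), mul_comm s]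
    exact Nat.floor_le zero_le
  refine tendsto_nhdsWithin_of_tendsto_nhds_of_eventually_within _ ?_ (.of_forall h1)
  refine tendsto_of_tendsto_of_tendsto_of_le_of_le tendsto_const_nhds ?_ (fun n => (h1 n).le) h2
  have h3 : Tendsto (fun n : ℕ => 1 / ((n : ℝ≥0) + 1)) atTop (𝓝 0) := by
    rw [← NNReal.tendsto_coe]
    push_cast
    exact tendsto_one_div_add_atTop_nhds_zero_nat
  simpa using tendsto_const_nhds.add h3

variable {Ω : Type*} [mΩ : MeasurableSpace Ω] {μ : Measure Ω}
  {ℱ : Filtration ℝ≥0 mΩ} {X : ℝ≥0 → Ω → FinLowerSet P}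

theorem tendsto_grid_value {x : ℝ≥0 → FinLowerSet P} (hx : ∀ t, ∀ᶠ s in 𝓝[>] t, x s = x t)
    (g : FinLowerSet P → ℝ) (s : ℝ≥0) :
    Tendsto (fun n => g (x (gridTime n s))) atTop (𝓝 (g (x s))) := by
  refine tendsto_const_nhds.congr' ?_
  filter_upwards [(tendsto_gridTime s).eventually (hx s)] with n hn
  rw [hn]

theorem measurable_gridIndex (n : ℕ) :
    Measurable fun s : ℝ => ⌊((n : ℝ≥0) + 1) * s.toNNReal⌋₊ :=
  Nat.measurable_floor.comp (measurable_real_toNNReal.const_mul _)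

theorem measurable_path {x : ℝ≥0 → FinLowerSet P} (hx : ∀ t, ∀ᶠ s in 𝓝[>] t, x s = x t)
    (g : FinLowerSet P → ℝ) : Measurable fun s : ℝ => g (x s.toNNReal) := by
  refine measurable_of_tendsto_metrizable (f := fun n (s : ℝ) => g (x (gridTime n s.toNNReal)))
    (fun n => ?_) (tendsto_pi_nhds.2 fun s => tendsto_grid_value hx g _)
  exact (measurable_from_top (f := fun m : ℕ => g (x ((m + 1) / ((n : ℝ≥0) + 1))))).comp
    (measurable_gridIndex n)

theorem intervalIntegrable_path {x : ℝ≥0 → FinLowerSet P}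
    (hx : ∀ t, ∀ᶠ s in 𝓝[>] t, x s = x t)
    {g : FinLowerSet P → ℝ} {c : ℝ} (hg : ∀ A, |g A| ≤ c) (a b : ℝ) :
    IntervalIntegrable (fun s => g (x s.toNNReal)) volume a b := by
  exact (intervalIntegrable_const (c := c)).mono_fun'
    (measurable_path hx g).aestronglyMeasurable (.of_forall fun _ => hg _)

namespace IsGrowthProcess

theorem measurable_comp (hX : IsGrowthProcess lam μ ℱ X) (g : FinLowerSet P → ℝ) (t : ℝ≥0) :
    Measurable fun ω => g (X t ω) :=
  measurable_from_top.comp ((hX.adapted t).mono (ℱ.le t) le_rfl)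

/-- By right-continuity the process is almost surely the limit of its values on grids to the right,
which are jointly measurable. Exchanging time integrals and expectations depends on this. -/
theorem aestronglyMeasurable_prod (hX : IsGrowthProcess lam μ ℱ X) (g : FinLowerSet P → ℝ)
    (ν : Measure ℝ) [SFinite ν] :
    AEStronglyMeasurable (fun p : ℝ × Ω => g (X p.1.toNNReal p.2)) (ν.prod μ) := by
  refine aestronglyMeasurable_of_tendsto_ae atTop
    (f := fun n (p : ℝ × Ω) => g (X (gridTime n p.1.toNNReal) p.2)) (fun n => ?_) ?_
  · refine Measurable.aestronglyMeasurable ?_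
    have h : Measurable fun p : ℕ × Ω => g (X ((p.1 + 1) / ((n : ℝ≥0) + 1)) p.2) :=
      measurable_from_prod_countable_right fun m =>
        hX.measurable_comp g ((m + 1) / ((n : ℝ≥0) + 1))
    simp only [gridTime]
    exact h.comp (g := fun p : ℕ × Ω => g (X ((p.1 + 1) / ((n : ℝ≥0) + 1)) p.2))
      (f := fun p : ℝ × Ω => (⌊((n : ℝ≥0) + 1) * p.1.toNNReal⌋₊, p.2))
      (((measurable_gridIndex n).comp measurable_fst).prodMk measurable_snd)
  · filter_upwards [Measure.quasiMeasurePreserving_snd.ae hX.rightCts] with p hp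
    exact tendsto_grid_value hp g _

variable [IsProbabilityMeasure μ]

theorem integrable_comp (hX : IsGrowthProcess lam μ ℱ X) {g : FinLowerSet P → ℝ} {c : ℝ}
    (hg : ∀ A, |g A| ≤ c) (t : ℝ≥0) :
    Integrable (fun ω => g (X t ω)) μ :=
  .of_bound (hX.measurable_comp g t).aestronglyMeasurable c (.of_forall fun _ => hg _)

theorem integrable_prod (hX : IsGrowthProcess lam μ ℱ X) {g : FinLowerSet P → ℝ} {c : ℝ}
    (hg : ∀ A, |g A| ≤ c) (ν : Measure ℝ)
    [IsFiniteMeasure ν] : Integrable (fun p : ℝ × Ω => g (X p.1.toNNReal p.2)) (ν.prod μ) :=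
  .of_bound (hX.aestronglyMeasurable_prod g ν) c (.of_forall fun _ => hg _)

theorem integrable_timeIntegral (hX : IsGrowthProcess lam μ ℱ X) {g : FinLowerSet P → ℝ} {c : ℝ}
    (hg : ∀ A, |g A| ≤ c)
    (t : ℝ≥0) : Integrable (fun ω => ∫ s in (0 : ℝ)..t, g (X s.toNNReal ω)) μ := by
  simp only [intervalIntegral.integral_of_le t.coe_nonneg]
  exact (hX.integrable_prod hg (volume.restrict (Set.Ioc 0 (t : ℝ)))).integral_prod_right

theorem integral_timeIntegral (hX : IsGrowthProcess lam μ ℱ X) {g : FinLowerSet P → ℝ} {c : ℝ}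
    (hg : ∀ A, |g A| ≤ c) (t : ℝ≥0) :
    ∫ ω, (∫ s in (0 : ℝ)..t, g (X s.toNNReal ω)) ∂μ =
      ∫ s in (0 : ℝ)..t, ∫ ω, g (X s.toNNReal ω) ∂μ := by
  simp only [intervalIntegral.integral_of_le t.coe_nonneg]
  exact (integral_integral_swap
    (hX.integrable_prod hg (volume.restrict (Set.Ioc 0 (t : ℝ))))).symm

/-- The process does not come close to infinity: the rate at which it leaves the large finite sets
tends to zero in mean. -/
theorem tendsto_integral_exit (hX : IsGrowthProcess lam μ ℱ X) (hfin : IsLocallyFinite P)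
    (t : ℝ≥0) :
    Tendsto (fun k => ∫ ω, (∫ s in (0 : ℝ)..t,
      - generator lam (cutoff (level P k) fun _ => 1) (X s.toNNReal ω)) ∂μ) atTop (𝓝 0) := by
  have hb : ∀ k A, |cutoff (P := P) (level P k) (fun _ => 1) A| ≤ 1 := fun k A => by
    rw [cutoff]
    split_ifs <;> simp
  -- By the martingale property of the indicator, the accumulated exit rate is the probability of
  -- having left `level P k` by time `t`. It vanishes in the limit since each state is finite.
  have h1 : ∀ k, ∫ ω, (∫ s in (0 : ℝ)..t,
      - generator lam (cutoff (level P k) fun _ => 1) (X s.toNNReal ω)) ∂μ =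
      1 - ∫ ω, cutoff (level P k) (fun _ => 1) (X t ω) ∂μ := by
    intro k
    have hm := hX.martingale _ (finite_support_cutoff (finite_level hfin k) fun _ => 1)
    have h2 := hm.setIntegral_eq (zero_le (a := t)) MeasurableSet.univ
    simp only [Measure.restrict_univ, NNReal.coe_zero, intervalIntegral.integral_same,
      sub_zero] at h2
    obtain ⟨c, hc⟩ := exists_abs_le_of_finite_support
      (finite_support_generator_cutoff_one (lam := lam) hfin (finite_level hfin k))
    rw [integral_sub (hX.integrable_comp (hb k) t) (hX.integrable_timeIntegral hc t)] at h2
    have h3 : ∫ ω, cutoff (level P k) (fun _ => 1) (X 0 ω) ∂μ = 1 := by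
      rw [integral_congr_ae (g := fun _ => (1 : ℝ))]
      · simp
      · filter_upwards [hX.initial] with ω hω
        simp [hω, cutoff, FinLowerSet.empty]
    rw [h3] at h2
    simp only [intervalIntegral.integral_neg, integral_neg]
    linarith
  have h2 : Tendsto (fun k => ∫ ω, cutoff (level P k) (fun _ => 1) (X t ω) ∂μ) atTop
      (𝓝 (∫ _, (1 : ℝ) ∂μ)) := by
    refine tendsto_integral_of_dominated_convergence (fun _ => 1)
      (fun k => (hX.measurable_comp _ t).aestronglyMeasurable) (integrable_const _)
      (fun k => .of_forall fun ω => hb k _) (.of_forall fun ω => ?_)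
    refine tendsto_const_nhds.congr' ?_
    filter_upwards [eventually_subset_level hfin (X t ω).finite] with k hk
    simp [cutoff, hk]
  simp only [h1]
  simpa using (tendsto_const_nhds (x := (1 : ℝ))).sub h2

/-- The martingale property, for functions that depend only on the part of the state inside a finite
lower set. -/
theorem setIntegral_eq (hX : IsGrowthProcess lam μ ℱ X) (hlam : ∀ x, 0 < lam x)
    (hfin : IsLocallyFinite P) {B : Finset P}
    (hB : IsLowerSet (B : Set P)) {f : Set P → ℝ} (hf : ∀ S, f (S ∩ B) = f S) {s t : ℝ≥0}
    (hst : s ≤ t) {F : Set Ω} (hF : MeasurableSet[ℱ s] F) :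
    ∫ ω in F, (f (X s ω).carrier -
      ∫ r in (0 : ℝ)..s, drift lam B f (X r.toNNReal ω).carrier) ∂μ =
    ∫ ω in F, (f (X t ω).carrier -
      ∫ r in (0 : ℝ)..t, drift lam B f (X r.toNNReal ω).carrier) ∂μ := by
  obtain ⟨c, hc⟩ := exists_abs_le_of_local hf
  obtain ⟨d, hd⟩ := exists_abs_le_of_local (drift_inter (lam := lam) hB hf)
  have hc0 : 0 ≤ c := (abs_nonneg _).trans (hc ∅)
  have hd0 : 0 ≤ d := (abs_nonneg _).trans (hd ∅)
  have hcut : ∀ {h : Set P → ℝ} {e : ℝ}, (∀ S, |h S| ≤ e) → ∀ k (A : FinLowerSet P),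
      |cutoff (level P k) h A| ≤ e := fun hh k A => by
    rw [cutoff]
    split_ifs
    · exact hh _
    · simpa using (abs_nonneg _).trans (hh ∅)
  have htend : ∀ (h : Set P → ℝ) (A : FinLowerSet P),
      Tendsto (fun k => cutoff (level P k) h A) atTop (𝓝 (h A.carrier)) := fun h A => by
    refine tendsto_const_nhds.congr' ?_
    filter_upwards [eventually_subset_level hfin A.finite] with k hk
    simp [cutoff, hk]
  -- Dominated convergence handles the truncated drift (`h1`). The error term of `generator_cutoff`
  -- is at most `c` times the accumulated exit rate, which tends to zero (`h2`, `h3`).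
  have key : ∀ u : ℝ≥0, Tendsto (fun k => ∫ ω in F, (cutoff (level P k) f (X u ω) -
      ∫ r in (0 : ℝ)..u, generator lam (cutoff (level P k) f) (X r.toNNReal ω)) ∂μ) atTop
      (𝓝 (∫ ω in F, (f (X u ω).carrier -
        ∫ r in (0 : ℝ)..u, drift lam B f (X r.toNNReal ω).carrier) ∂μ)) := by
    intro u
    have h1 : Tendsto (fun k => ∫ ω in F, (cutoff (level P k) f (X u ω) -
        ∫ r in (0 : ℝ)..u, cutoff (level P k) (drift lam B f) (X r.toNNReal ω)) ∂μ) atTop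
        (𝓝 (∫ ω in F, (f (X u ω).carrier -
          ∫ r in (0 : ℝ)..u, drift lam B f (X r.toNNReal ω).carrier) ∂μ)) := by
      refine tendsto_integral_of_dominated_convergence (fun _ => c + d * |(u : ℝ) - 0|)
        (fun k => ?_) (integrable_const _) (fun k => .of_forall fun ω => ?_) ?_
      · exact ((hX.integrable_comp (hcut hc k) u).sub
          (hX.integrable_timeIntegral (hcut hd k) u)).aestronglyMeasurable.restrict
      · refine (norm_sub_le _ _).trans (add_le_add (hcut hc k _) ?_)
        exact intervalIntegral.norm_integral_le_of_norm_le_const fun r _ => hcut hd k _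
      · filter_upwards [ae_restrict_of_ae hX.rightCts] with ω hω
        refine (htend f _).sub ?_
        refine intervalIntegral.tendsto_integral_filter_of_dominated_convergence (fun _ => d)
          (.of_forall fun k => ?_) (.of_forall fun k => .of_forall fun r _ => hcut hd k _)
          intervalIntegrable_const (.of_forall fun r _ => htend _ _)
        exact (measurable_path (x := fun t => X t ω) hω _).aestronglyMeasurable
    have h2 : ∀ᶠ k in atTop, |(∫ ω in F, (cutoff (level P k) f (X u ω) -
        ∫ r in (0 : ℝ)..u, generator lam (cutoff (level P k) f) (X r.toNNReal ω)) ∂μ) -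
        ∫ ω in F, (cutoff (level P k) f (X u ω) -
        ∫ r in (0 : ℝ)..u, cutoff (level P k) (drift lam B f) (X r.toNNReal ω)) ∂μ| ≤
        c * ∫ ω, (∫ s in (0 : ℝ)..u,
          - generator lam (cutoff (level P k) fun _ => 1) (X s.toNNReal ω)) ∂μ := by
      filter_upwards [eventually_subset_level hfin B.finite_toSet] with k hk
      obtain ⟨e, he⟩ := exists_abs_le_of_finite_support
        (finite_support_generator_cutoff_one (lam := lam) hfin (finite_level hfin k))
      have he' : ∀ A, |- generator lam (cutoff (level P k) fun _ => 1) A| ≤ e := fun A => by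
        rw [abs_neg]
        exact he A
      have hg : ∀ A : FinLowerSet P,
          |f A.carrier * generator lam (cutoff (level P k) fun _ => 1) A| ≤ c * e := fun A => by
        rw [abs_mul]
        exact mul_le_mul (hc _) (he A) (abs_nonneg _) hc0
      have hgen : ∀ A, |generator lam (cutoff (level P k) f) A| ≤ d + c * e := fun A => by
        rw [generator_cutoff hfin hk hf]
        exact (abs_add_le _ _).trans (add_le_add (hcut hd k _) (hg A))
      have hI : ∀ {g : FinLowerSet P → ℝ} {b : ℝ}, (∀ A, |g A| ≤ b) →
          Integrable (fun ω => cutoff (level P k) f (X u ω) -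
            ∫ r in (0 : ℝ)..u, g (X r.toNNReal ω)) (μ.restrict F) := fun hg =>
        ((hX.integrable_comp (hcut hc k) u).sub (hX.integrable_timeIntegral hg u)).restrict
      rw [← integral_sub (hI hgen) (hI (hcut hd k))]
      have hexit := hX.integrable_timeIntegral he' u
      have hnn : ∀ ω, 0 ≤ ∫ s in (0 : ℝ)..u,
          - generator lam (cutoff (level P k) fun _ => 1) (X s.toNNReal ω) := fun ω =>
        intervalIntegral.integral_nonneg u.coe_nonneg fun r _ =>
          neg_nonneg.2 (generator_cutoff_one_nonpos hlam hfin _ _)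
      calc _ ≤ ∫ ω in F, (c * ∫ s in (0 : ℝ)..u,
            - generator lam (cutoff (level P k) fun _ => 1) (X s.toNNReal ω)) ∂μ := by
            rw [← Real.norm_eq_abs]
            refine norm_integral_le_of_norm_le (hexit.const_mul c).restrict ?_
            filter_upwards [ae_restrict_of_ae hX.rightCts] with ω hω
            rw [sub_sub_sub_cancel_left, ← intervalIntegral.integral_sub
              (intervalIntegrable_path (x := fun t => X t ω) hω (hcut hd k) _ _)
              (intervalIntegrable_path (x := fun t => X t ω) hω hgen _ _),
              ← intervalIntegral.integral_const_mul]
            refine intervalIntegral.norm_integral_le_of_norm_le u.coe_nonneg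
              (.of_forall fun r _ => ?_)
              ((intervalIntegrable_path (x := fun t => X t ω) hω he' _ _).const_mul c)
            rw [generator_cutoff hfin hk hf, sub_add_cancel_left, norm_neg, Real.norm_eq_abs,
              abs_mul, ← abs_neg (generator _ _ _),
              abs_of_nonneg (neg_nonneg.2 (generator_cutoff_one_nonpos hlam hfin _ _))]
            exact mul_le_mul_of_nonneg_right (hc _)
              (neg_nonneg.2 (generator_cutoff_one_nonpos hlam hfin _ _))
        _ ≤ ∫ ω, (c * ∫ s in (0 : ℝ)..u,
            - generator lam (cutoff (level P k) fun _ => 1) (X s.toNNReal ω)) ∂μ :=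
            setIntegral_le_integral (hexit.const_mul c)
              (.of_forall fun ω => mul_nonneg hc0 (hnn ω))
        _ = _ := integral_const_mul _ _
    have h3 := (hX.tendsto_integral_exit hfin u).const_mul c
    rw [mul_zero] at h3
    have h4 := squeeze_zero_norm' (h2.mono fun k hk => (Real.norm_eq_abs _).le.trans hk) h3
    simpa using h4.add h1
  refine tendsto_nhds_unique ((key s).congr fun k => ?_) (key t)
  exact (hX.martingale _ (finite_support_cutoff (finite_level hfin k) f)).setIntegral_eq hst hF

end IsGrowthProcess

end Dynamics

end CrystalGrowth

end

noncomputable section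

namespace CrystalGrowth

/-! ### Moments of the covering time of the process. -/

section CoverTime

variable {P : Type*} [PartialOrder P] {lam : P → ℝ} {Ω : Type*} {X : ℝ≥0 → Ω → FinLowerSet P}
  {B : Finset P}

/-- The infimum is attained: a state that fails to cover `B` persists for a positive time, and
covering is never undone. -/
theorem coverTime_le_iff {ω : Ω} (hω : ∀ t, ∀ᶠ s in 𝓝[>] t, X s ω = X t ω)
    (hmono : ∀ s t, s ≤ t → (B : Set P) ⊆ (X s ω).carrier → (B : Set P) ⊆ (X t ω).carrier)
    (t : ℝ≥0) : coverTime X B ω ≤ t ↔ (B : Set P) ⊆ (X t ω).carrier := by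
  refine ⟨fun h => ?_, fun h => iInf₂_le t h⟩
  by_contra hB
  obtain ⟨u, hu, htu⟩ := ((hω t).and self_mem_nhdsWithin).exists
  have h1 : (u : ℝ≥0∞) ≤ coverTime X B ω := by
    refine le_iInf₂ fun s hs => ?_
    by_contra! hsu
    refine hB ?_
    rw [← hu]
    exact hmono s u (by exact_mod_cast hsu.le) hs
  exact (h1.trans h).not_gt (by exact_mod_cast htu)

open Classical in
/-- The indicator of the event that `B` is not covered. -/
def uncovered {P : Type*} (B : Finset P) (S : Set P) : ℝ := if (B : Set P) ⊆ S then 0 else 1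

theorem abs_uncovered_le {P : Type*} {B : Finset P} (S : Set P) : |uncovered B S| ≤ 1 := by
  rw [uncovered]
  split_ifs <;> simp

theorem integral_uncovered {ω : Ω}
    (hτ : ∀ t : ℝ≥0, coverTime X B ω ≤ t ↔ (B : Set P) ⊆ (X t ω).carrier) (t : ℝ≥0) :
    ∫ s in (0 : ℝ)..t, uncovered B (X s.toNNReal ω).carrier =
      (min (t : ℝ≥0∞) (coverTime X B ω)).toReal := by
  set τ := coverTime X B ω with hτdef
  set m := (min (t : ℝ≥0∞) τ).toReal with hm
  have hfin : min (t : ℝ≥0∞) τ ≠ ∞ := ((min_le_left _ _).trans_lt ENNReal.coe_lt_top).ne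
  have hmt : m ≤ t := by
    simpa using ENNReal.toReal_mono ENNReal.coe_ne_top (min_le_left (t : ℝ≥0∞) τ)
  have hm0 : 0 ≤ m := ENNReal.toReal_nonneg
  have h1 : Set.EqOn (fun s : ℝ => uncovered B (X s.toNNReal ω).carrier) (fun _ => 1)
      (Set.Ioo 0 m) := by
    intro s hs
    simp only [uncovered, ← hτ]
    refine if_neg fun h => hs.2.not_ge ?_
    have h2 : min (t : ℝ≥0∞) τ ≤ (s.toNNReal : ℝ≥0∞) := (min_le_right _ _).trans h
    simpa [hs.1.le] using ENNReal.toReal_mono ENNReal.coe_ne_top h2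
  have h2 : Set.EqOn (fun s : ℝ => uncovered B (X s.toNNReal ω).carrier) (fun _ => 0)
      (Set.Ioo m t) := by
    intro s hs
    simp only [uncovered, ← hτ]
    refine if_pos ?_
    have hs0 : 0 ≤ s := hm0.trans hs.1.le
    by_contra! hlt
    have h3 : (s.toNNReal : ℝ≥0∞) ≤ min (t : ℝ≥0∞) τ :=
      le_min (by exact_mod_cast Real.toNNReal_le_iff_le_coe.2 hs.2.le) hlt.le
    have h4 : s ≤ m := by simpa [hs0] using ENNReal.toReal_mono hfin h3
    exact hs.1.not_ge h4
  have i1 : IntervalIntegrable (fun s : ℝ => uncovered B (X s.toNNReal ω).carrier) volume 0 m :=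
    (intervalIntegrable_congr_uIoo (Set.uIoo_of_le hm0 ▸ h1)).2 intervalIntegrable_const
  have i2 : IntervalIntegrable (fun s : ℝ => uncovered B (X s.toNNReal ω).carrier) volume m t :=
    (intervalIntegrable_congr_uIoo (Set.uIoo_of_le hmt ▸ h2)).2 intervalIntegrable_const
  rw [← intervalIntegral.integral_add_adjacent_intervals i1 i2,
    intervalIntegral.integral_congr_Ioo_of_le hm0 h1,
    intervalIntegral.integral_congr_Ioo_of_le hmt h2]
  simp

theorem drift_of_subset {f : Set P → ℝ} {S : Set P} (h : (B : Set P) ⊆ S) :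
    drift lam B f S = 0 := by
  refine Finset.sum_eq_zero fun α hα => ?_
  exact absurd (h (mem_front.1 hα).1) (mem_front.1 hα).2.1

theorem drift_meanTime (hlam : ∀ x, 0 < lam x) (hB : IsLowerSet (B : Set P)) (S : Set P) :
    drift lam B (meanTime lam B) S = - uncovered B S := by
  rw [uncovered]
  split_ifs with h
  · rw [drift_of_subset h, neg_zero]
  · exact drift_expect hlam hB h

theorem drift_sqTime (hlam : ∀ x, 0 < lam x) (hB : IsLowerSet (B : Set P)) (S : Set P) :
    drift lam B (sqTime lam B) S = - (2 * meanTime lam B S) := by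
  by_cases h : (B : Set P) ⊆ S
  · rw [drift_of_subset h, meanTime, expect_of_subset h, mul_zero, neg_zero]
  · exact drift_expect hlam hB h

theorem sqTime_inter (hlam : ∀ x, 0 < lam x) (hB : IsLowerSet (B : Set P)) (S : Set P) :
    sqTime lam B (S ∩ B) = sqTime lam B S :=
  expect_inter hlam hB (fun S => by rw [meanTime_inter hlam hB]) S

theorem sqTime_nonneg (hlam : ∀ x, 0 < lam x) (hB : IsLowerSet (B : Set P)) (S : Set P) :
    0 ≤ sqTime lam B S :=
  expect_nonneg hlam hB (fun S => mul_nonneg zero_le_two (meanTime_nonneg hlam hB S)) S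

theorem lintegral_le_of_tendsto {α : Type*} [MeasurableSpace α] {μ : Measure α}
    {f : ℕ → α → ℝ≥0∞} {g : α → ℝ≥0∞} {K : ℝ≥0∞} (hf : ∀ n, AEMeasurable (f n) μ)
    (hlim : ∀ᵐ x ∂μ, Tendsto (fun n => f n x) atTop (𝓝 (g x))) (hK : ∀ n, ∫⁻ x, f n x ∂μ ≤ K) :
    ∫⁻ x, g x ∂μ ≤ K := by
  calc ∫⁻ x, g x ∂μ = ∫⁻ x, liminf (fun n => f n x) atTop ∂μ :=
        lintegral_congr_ae (hlim.mono fun x hx => hx.liminf_eq.symm)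
    _ ≤ liminf (fun n => ∫⁻ x, f n x ∂μ) atTop := lintegral_liminf_le' hf
    _ ≤ K := liminf_le_of_frequently_le' (.of_forall hK)

theorem sq_div_two_le_integral {m T : ℝ} (hm : 0 ≤ m) (hmT : m ≤ T) :
    m ^ 2 / 2 ≤ ∫ r in (0 : ℝ)..T, (m - min r m) := by
  have hc : Continuous fun r : ℝ => m - min r m := by fun_prop
  calc m ^ 2 / 2 = ∫ r in (0 : ℝ)..m, (m - r) := by
        rw [intervalIntegral.integral_sub (by simp) (by simp)]
        simp
        ring
    _ = ∫ r in (0 : ℝ)..m, (m - min r m) := by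
        refine intervalIntegral.integral_congr fun r hr => ?_
        rw [Set.uIcc_of_le hm] at hr
        simp only [min_eq_left hr.2]
    _ ≤ _ := by
        rw [← intervalIntegral.integral_add_adjacent_intervals (hc.intervalIntegrable 0 m)
          (hc.intervalIntegrable m T)]
        exact le_add_of_nonneg_right (intervalIntegral.integral_nonneg hmT fun r _ =>
          sub_nonneg.2 (min_le_right _ _))

variable [mΩ : MeasurableSpace Ω] {μ : Measure Ω} [IsProbabilityMeasure μ]
  {ℱ : Filtration ℝ≥0 mΩ}

namespace IsGrowthProcess

theorem integral_initial (hX : IsGrowthProcess lam μ ℱ X) (f : Set P → ℝ) :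
    ∫ ω, f (X 0 ω).carrier ∂μ = f ∅ := by
  rw [integral_congr_ae (g := fun _ => f ∅)]
  · simp
  · filter_upwards [hX.initial] with ω hω
    rw [hω]
    rfl

/-- Dynkin's formula. -/
theorem integral_comp_eq (hX : IsGrowthProcess lam μ ℱ X) (hlam : ∀ x, 0 < lam x)
    (hfin : IsLocallyFinite P) (hB : IsLowerSet (B : Set P)) {f : Set P → ℝ}
    (hf : ∀ S, f (S ∩ B) = f S) (t : ℝ≥0) :
    ∫ ω, f (X t ω).carrier ∂μ =
      f ∅ + ∫ ω, (∫ r in (0 : ℝ)..t, drift lam B f (X r.toNNReal ω).carrier) ∂μ := by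
  have h := hX.setIntegral_eq hlam hfin hB hf (zero_le (a := t)) MeasurableSet.univ
  obtain ⟨c, hc⟩ := exists_abs_le_of_local hf
  obtain ⟨d, hd⟩ := exists_abs_le_of_local (drift_inter (lam := lam) hB hf)
  simp only [Measure.restrict_univ, NNReal.coe_zero, intervalIntegral.integral_same,
    sub_zero] at h
  rw [integral_sub (hX.integrable_comp (g := fun A => f A.carrier) (fun A => hc _) t)
    (hX.integrable_timeIntegral (g := fun A => drift lam B f A.carrier) (fun A => hd _) t),
    hX.integral_initial] at h
  linarith

/-- Monotone paths are not part of the definition of the process. On the event that `B` is covered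
at time `s`, the function `uncovered B` starts from `0` and has nonpositive drift, so its mean at
time `t` vanishes. -/
theorem ae_subset_of_le (hX : IsGrowthProcess lam μ ℱ X) (hlam : ∀ x, 0 < lam x)
    (hfin : IsLocallyFinite P) (hB : IsLowerSet (B : Set P)) {s t : ℝ≥0} (hst : s ≤ t) :
    ∀ᵐ ω ∂μ, (B : Set P) ⊆ (X s ω).carrier → (B : Set P) ⊆ (X t ω).carrier := by
  have hloc : ∀ S, uncovered B (S ∩ B) = uncovered B S := fun S => by
    classical
    exact if_congr (Set.subset_inter_iff.trans (and_iff_left subset_rfl)) rfl rfl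
  set F : Set Ω := {ω | (B : Set P) ⊆ (X s ω).carrier} with hF
  have hFm : MeasurableSet[ℱ s] F :=
    hX.adapted s (show MeasurableSet {A : FinLowerSet P | (B : Set P) ⊆ A.carrier} from trivial)
  have hFm' : MeasurableSet F := ℱ.le s _ hFm
  have h := hX.setIntegral_eq hlam hfin hB hloc hst hFm
  obtain ⟨d, hd⟩ := exists_abs_le_of_local (drift_inter (lam := lam) hB hloc)
  have hI : ∀ u, Integrable (fun ω => uncovered B (X u ω).carrier) μ := fun u =>
    hX.integrable_comp (g := fun A => uncovered B A.carrier) (fun A => abs_uncovered_le _) u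
  have hJ : ∀ u : ℝ≥0, Integrable (fun ω => ∫ r in (0 : ℝ)..u,
      drift lam B (uncovered B) (X r.toNNReal ω).carrier) μ := fun u =>
    hX.integrable_timeIntegral (g := fun A => drift lam B (uncovered B) A.carrier)
      (fun A => hd _) u
  have hdrift : ∀ S, drift lam B (uncovered B) S ≤ 0 := fun S => by
    refine Finset.sum_nonpos fun α _ => mul_nonpos_of_nonneg_of_nonpos (hlam α).le ?_
    simp only [uncovered]
    split_ifs with h1 h2 h2
    · simp
    · simp
    · exact absurd (h2.trans (Set.subset_insert _ _)) h1
    · simp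
  rw [integral_sub (hI s).restrict (hJ s).restrict,
    integral_sub (hI t).restrict (hJ t).restrict] at h
  have h0 : ∫ ω in F, uncovered B (X s ω).carrier ∂μ = 0 :=
    setIntegral_eq_zero_of_forall_eq_zero fun ω hω => if_pos hω
  have hle : ∫ ω in F, (∫ r in (0 : ℝ)..t,
      drift lam B (uncovered B) (X r.toNNReal ω).carrier) ∂μ ≤ ∫ ω in F, (∫ r in (0 : ℝ)..s,
      drift lam B (uncovered B) (X r.toNNReal ω).carrier) ∂μ := by
    refine integral_mono_ae (hJ t).restrict (hJ s).restrict ?_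
    filter_upwards [ae_restrict_of_ae hX.rightCts] with ω hω
    have hi := intervalIntegrable_path (x := fun t => X t ω) hω
      (g := fun A => drift lam B (uncovered B) A.carrier) (fun A => hd _)
    rw [← intervalIntegral.integral_add_adjacent_intervals (hi 0 s) (hi s t)]
    refine add_le_of_nonpos_right ?_
    rw [← neg_nonneg, ← intervalIntegral.integral_neg]
    exact intervalIntegral.integral_nonneg (by exact_mod_cast hst) fun r _ =>
      neg_nonneg.2 (hdrift _)
  have hnn : ∀ ω, 0 ≤ uncovered B (X t ω).carrier := fun ω => by
    rw [uncovered]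
    split_ifs <;> simp
  have hzero : ∫ ω in F, uncovered B (X t ω).carrier ∂μ = 0 :=
    le_antisymm (by linarith) (integral_nonneg hnn)
  rw [integral_eq_zero_iff_of_nonneg hnn (hI t).restrict, EventuallyEq,
    ae_restrict_iff' hFm'] at hzero
  filter_upwards [hzero] with ω hω hωF
  by_contra hcon
  simpa [uncovered, hcon] using hω hωF

theorem ae_coverTime_le_iff (hX : IsGrowthProcess lam μ ℱ X) (hlam : ∀ x, 0 < lam x)
    (hfin : IsLocallyFinite P) (hB : IsLowerSet (B : Set P)) :
    ∀ᵐ ω ∂μ, ∀ t : ℝ≥0, coverTime X B ω ≤ t ↔ (B : Set P) ⊆ (X t ω).carrier := by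
  obtain ⟨Q, hQc, hQd⟩ := TopologicalSpace.exists_countable_dense ℝ≥0
  have h1 : ∀ᵐ ω ∂μ, ∀ s ∈ Q, ∀ t ∈ Q, s ≤ t →
      (B : Set P) ⊆ (X s ω).carrier → (B : Set P) ⊆ (X t ω).carrier := by
    rw [ae_ball_iff hQc]
    intro s _
    rw [ae_ball_iff hQc]
    intro t _
    by_cases hst : s ≤ t
    · filter_upwards [hX.ae_subset_of_le hlam hfin hB hst] with ω hω _ using hω
    · exact .of_forall fun ω h => absurd h hst
  filter_upwards [h1, hX.rightCts] with ω hω hrc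
  -- Right-continuity reproduces each state at a slightly later time in `Q`, which carries the
  -- almost sure comparison from countably many times to all.
  have happrox : ∀ s t : ℝ≥0, s < t → ∃ q ∈ Q, s < q ∧ q < t ∧ X q ω = X s ω := by
    intro s t hst
    obtain ⟨u, hu, hsub⟩ := (mem_nhdsGT_iff_exists_Ioo_subset' hst).1 (hrc s)
    obtain ⟨q, hqQ, hq⟩ := hQd.exists_between (lt_min hst hu)
    exact ⟨q, hqQ, hq.1, hq.2.trans_le (min_le_left _ _),
      hsub ⟨hq.1, hq.2.trans_le (min_le_right _ _)⟩⟩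
  refine coverTime_le_iff hrc fun s t hst hs => ?_
  rcases hst.eq_or_lt with rfl | hlt
  · exact hs
  · obtain ⟨q, hqQ, -, hqt, hq⟩ := happrox s t hlt
    obtain ⟨p, hpQ, htp, -, hp⟩ := happrox t (t + 1) (by simp)
    rw [← hp]
    exact hω q hqQ p hpQ (hqt.trans htp).le (hq ▸ hs)

theorem integrable_min_coverTime (hX : IsGrowthProcess lam μ ℱ X) (hlam : ∀ x, 0 < lam x)
    (hfin : IsLocallyFinite P) (hB : IsLowerSet (B : Set P)) (t : ℝ≥0) :
    Integrable (fun ω => (min (t : ℝ≥0∞) (coverTime X B ω)).toReal) μ := by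
  refine (hX.integrable_timeIntegral (g := fun A => uncovered B A.carrier)
    (fun A => abs_uncovered_le _) t).congr ?_
  filter_upwards [hX.ae_coverTime_le_iff hlam hfin hB] with ω hω
  exact integral_uncovered hω t

/-- Dynkin's formula: the drift of `meanTime` is minus the indicator that `B` is uncovered, which
integrates to the truncated covering time. -/
theorem integral_meanTime (hX : IsGrowthProcess lam μ ℱ X) (hlam : ∀ x, 0 < lam x)
    (hfin : IsLocallyFinite P) (hB : IsLowerSet (B : Set P)) (t : ℝ≥0) :
    ∫ ω, meanTime lam B (X t ω).carrier ∂μ =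
      meanTime lam B ∅ - ∫ ω, (min (t : ℝ≥0∞) (coverTime X B ω)).toReal ∂μ := by
  rw [hX.integral_comp_eq hlam hfin hB (meanTime_inter hlam hB) t, sub_eq_add_neg, ← integral_neg]
  congr 1
  refine integral_congr_ae ?_
  filter_upwards [hX.ae_coverTime_le_iff hlam hfin hB] with ω hω
  simp only [drift_meanTime hlam hB, intervalIntegral.integral_neg]
  rw [integral_uncovered hω t]

theorem tendsto_min_natCast (x : ℝ≥0∞) :
    Tendsto (fun n : ℕ => min (((n : ℝ≥0) : ℝ≥0∞)) x) atTop (𝓝 x) := by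
  have h : Tendsto (fun n : ℕ => min (((n : ℝ≥0) : ℝ≥0∞)) x) atTop (𝓝 (min ∞ x)) :=
    (ENNReal.tendsto_nat_nhds_top.congr fun n => by simp).min tendsto_const_nhds
  simpa using h

theorem aemeasurable_min_coverTime (hX : IsGrowthProcess lam μ ℱ X) (hlam : ∀ x, 0 < lam x)
    (hfin : IsLocallyFinite P) (hB : IsLowerSet (B : Set P)) (t : ℝ≥0) :
    AEMeasurable (fun ω => min (t : ℝ≥0∞) (coverTime X B ω)) μ := by
  refine (hX.integrable_min_coverTime hlam hfin hB t).aemeasurable.ennreal_ofReal.congr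
    (.of_forall fun ω => ENNReal.ofReal_toReal ?_)
  exact ((min_le_left _ _).trans_lt ENNReal.coe_lt_top).ne

theorem aemeasurable_coverTime (hX : IsGrowthProcess lam μ ℱ X) (hlam : ∀ x, 0 < lam x)
    (hfin : IsLocallyFinite P) (hB : IsLowerSet (B : Set P)) :
    AEMeasurable (coverTime X (B : Set P)) μ :=
  aemeasurable_of_tendsto_metrizable_ae atTop
    (fun n : ℕ => hX.aemeasurable_min_coverTime hlam hfin hB n)
    (.of_forall fun _ => tendsto_min_natCast _)

theorem lintegral_coverTime_le (hX : IsGrowthProcess lam μ ℱ X) (hlam : ∀ x, 0 < lam x)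
    (hfin : IsLocallyFinite P) (hB : IsLowerSet (B : Set P)) :
    ∫⁻ ω, coverTime X B ω ∂μ ≤ ENNReal.ofReal (meanTime lam B ∅) := by
  refine lintegral_le_of_tendsto (fun n : ℕ => hX.aemeasurable_min_coverTime hlam hfin hB n)
    (.of_forall fun ω => tendsto_min_natCast _) fun n => ?_
  have h1 : ∀ ω, min ((n : ℝ≥0) : ℝ≥0∞) (coverTime X B ω) =
      ENNReal.ofReal (min ((n : ℝ≥0) : ℝ≥0∞) (coverTime X B ω)).toReal := fun ω =>
    (ENNReal.ofReal_toReal ((min_le_left _ _).trans_lt ENNReal.coe_lt_top).ne).symm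
  rw [lintegral_congr h1, ← ofReal_integral_eq_lintegral_ofReal
    (hX.integrable_min_coverTime hlam hfin hB n) (.of_forall fun _ => ENNReal.toReal_nonneg)]
  refine ENNReal.ofReal_le_ofReal ?_
  have h2 := hX.integral_meanTime hlam hfin hB n
  have h3 : 0 ≤ ∫ ω, meanTime lam B (X n ω).carrier ∂μ :=
    integral_nonneg fun ω => meanTime_nonneg hlam hB _
  linarith

theorem ae_coverTime_ne_top (hX : IsGrowthProcess lam μ ℱ X) (hlam : ∀ x, 0 < lam x)
    (hfin : IsLocallyFinite P) (hB : IsLowerSet (B : Set P)) :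
    ∀ᵐ ω ∂μ, coverTime X (B : Set P) ω ≠ ∞ := by
  have h := ae_lt_top' (hX.aemeasurable_coverTime hlam hfin hB)
    ((hX.lintegral_coverTime_le hlam hfin hB).trans_lt ENNReal.ofReal_lt_top).ne
  filter_upwards [h] with ω hω using hω.ne

theorem integrable_coverTime (hX : IsGrowthProcess lam μ ℱ X) (hlam : ∀ x, 0 < lam x)
    (hfin : IsLocallyFinite P) (hB : IsLowerSet (B : Set P)) :
    Integrable (fun ω => (coverTime X (B : Set P) ω).toReal) μ :=
  integrable_toReal_of_lintegral_ne_top (hX.aemeasurable_coverTime hlam hfin hB)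
    ((hX.lintegral_coverTime_le hlam hfin hB).trans_lt ENNReal.ofReal_lt_top).ne

/-- Let `t → ∞` in `integral_meanTime`. Since `meanTime` is bounded and vanishes once `B` is
covered, the remainder tends to zero. -/
theorem integral_coverTime (hX : IsGrowthProcess lam μ ℱ X) (hlam : ∀ x, 0 < lam x)
    (hfin : IsLocallyFinite P) (hB : IsLowerSet (B : Set P)) :
    ∫ ω, (coverTime X (B : Set P) ω).toReal ∂μ = meanTime lam B ∅ := by
  obtain ⟨c, hc⟩ := exists_abs_le_of_local (meanTime_inter hlam hB)
  have h1 : Tendsto (fun n : ℕ => ∫ ω, (min ((n : ℝ≥0) : ℝ≥0∞) (coverTime X B ω)).toReal ∂μ)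
      atTop (𝓝 (∫ ω, (coverTime X (B : Set P) ω).toReal ∂μ)) := by
    refine tendsto_integral_of_dominated_convergence (fun ω => (coverTime X (B : Set P) ω).toReal)
      (fun n => (hX.integrable_min_coverTime hlam hfin hB n).aestronglyMeasurable)
      (hX.integrable_coverTime hlam hfin hB) (fun n => ?_) ?_
    · filter_upwards [hX.ae_coverTime_ne_top hlam hfin hB] with ω hω
      rw [Real.norm_of_nonneg ENNReal.toReal_nonneg]
      exact ENNReal.toReal_mono hω (min_le_right _ _)
    · filter_upwards [hX.ae_coverTime_ne_top hlam hfin hB] with ω hω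
      exact (ENNReal.tendsto_toReal hω).comp (tendsto_min_natCast _)
  have h2 : Tendsto (fun n : ℕ => ∫ ω, meanTime lam B (X n ω).carrier ∂μ) atTop
      (𝓝 (∫ _, (0 : ℝ) ∂μ)) := by
    refine tendsto_integral_of_dominated_convergence (fun _ => c)
      (fun n => (hX.measurable_comp (fun A => meanTime lam B A.carrier) n).aestronglyMeasurable)
      (integrable_const _) (fun n => .of_forall fun ω => hc _) ?_
    filter_upwards [hX.ae_coverTime_ne_top hlam hfin hB,
      hX.ae_coverTime_le_iff hlam hfin hB] with ω h1 h2
    refine tendsto_const_nhds.congr' ?_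
    filter_upwards [eventually_ge_atTop ⌈(coverTime X (B : Set P) ω).toNNReal⌉₊] with n hn
    have h3 : coverTime X (B : Set P) ω ≤ (n : ℝ≥0) := by
      rw [← ENNReal.coe_toNNReal h1]
      exact_mod_cast Nat.ceil_le.1 hn
    exact (expect_of_subset ((h2 n).1 h3)).symm
  have h3 := h1.add h2
  rw [integral_zero, add_zero] at h3
  refine tendsto_nhds_unique h3 (tendsto_const_nhds.congr fun n => ?_)
  rw [hX.integral_meanTime hlam hfin hB]
  ring

/-- Dynkin's formula for `sqTime` bounds twice the mean time integral of `meanTime`. At time `r` the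
mean of `meanTime` equals that of `τ - min r τ`, which dominates `m - min r m` for the truncation `m
= min T τ`; the latter integrates to at least `m ^ 2 / 2`. No conditional expectations are needed.
-/
theorem integral_min_sq_le (hX : IsGrowthProcess lam μ ℱ X) (hlam : ∀ x, 0 < lam x)
    (hfin : IsLocallyFinite P) (hB : IsLowerSet (B : Set P)) (T : ℝ≥0) :
    ∫ ω, (min (T : ℝ≥0∞) (coverTime X B ω)).toReal ^ 2 ∂μ ≤ sqTime lam B ∅ := by
  obtain ⟨c, hc⟩ := exists_abs_le_of_local (meanTime_inter hlam hB)
  set m : Ω → ℝ := fun ω => (min (T : ℝ≥0∞) (coverTime X B ω)).toReal with hm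
  have hmint : Integrable m μ := hX.integrable_min_coverTime hlam hfin hB T
  have hm0 : ∀ ω, 0 ≤ m ω := fun ω => ENNReal.toReal_nonneg
  have hmT : ∀ ω, m ω ≤ T := fun ω => by
    simpa using ENNReal.toReal_mono ENNReal.coe_ne_top (min_le_left (T : ℝ≥0∞) (coverTime X B ω))
  have hprod : Integrable (fun p : ℝ × Ω => m p.2 - min p.1 (m p.2))
      ((volume.restrict (Set.Ioc 0 (T : ℝ))).prod μ) := by
    have h1 : AEStronglyMeasurable (fun p : ℝ × Ω => m p.2)
        ((volume.restrict (Set.Ioc 0 (T : ℝ))).prod μ) := hmint.aestronglyMeasurable.comp_snd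
    have h2 : AEStronglyMeasurable (fun p : ℝ × Ω => p.1)
        ((volume.restrict (Set.Ioc 0 (T : ℝ))).prod μ) :=
      measurable_fst.aestronglyMeasurable
    refine .of_bound (h1.sub (h2.inf h1)) T ?_
    have h3 : ∀ᵐ r ∂(volume.restrict (Set.Ioc 0 (T : ℝ))), r ∈ Set.Ioc 0 (T : ℝ) :=
      ae_restrict_mem measurableSet_Ioc
    filter_upwards [Measure.quasiMeasurePreserving_fst.ae h3] with p hp
    rw [Real.norm_of_nonneg (sub_nonneg.2 (min_le_right _ _))]
    have := le_min hp.1.le (hm0 p.2)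
    linarith [hmT p.2]
  have h1 : 2 * ∫ ω, (∫ r in (0 : ℝ)..T, meanTime lam B (X r.toNNReal ω).carrier) ∂μ ≤
      sqTime lam B ∅ := by
    have h := hX.integral_comp_eq hlam hfin hB (sqTime_inter hlam hB) T
    simp only [drift_sqTime hlam hB, intervalIntegral.integral_neg,
      intervalIntegral.integral_const_mul, integral_neg, integral_const_mul] at h
    have h' : 0 ≤ ∫ ω, sqTime lam B (X T ω).carrier ∂μ :=
      integral_nonneg fun ω => sqTime_nonneg hlam hB _
    linarith
  have h2 : ∫ ω, (∫ r in (0 : ℝ)..T, (m ω - min r (m ω))) ∂μ ≤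
      ∫ ω, (∫ r in (0 : ℝ)..T, meanTime lam B (X r.toNNReal ω).carrier) ∂μ := by
    rw [hX.integral_timeIntegral (g := fun A => meanTime lam B A.carrier) (fun A => hc _) T]
    simp only [intervalIntegral.integral_of_le T.coe_nonneg]
    rw [← integral_integral_swap hprod]
    refine integral_mono_ae hprod.integral_prod_left
      (hX.integrable_prod (g := fun A => meanTime lam B A.carrier) (fun A => hc _)
        (volume.restrict (Set.Ioc 0 (T : ℝ)))).integral_prod_left ?_
    filter_upwards [ae_restrict_mem measurableSet_Ioc] with r hr
    rw [hX.integral_meanTime hlam hfin hB, ← hX.integral_coverTime hlam hfin hB, ← integral_sub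
      (hX.integrable_coverTime hlam hfin hB) (hX.integrable_min_coverTime hlam hfin hB _)]
    have hmin : Integrable (fun ω => min r (m ω)) μ := (integrable_const r).inf hmint
    refine integral_mono_ae (hmint.sub hmin)
      ((hX.integrable_coverTime hlam hfin hB).sub
        (hX.integrable_min_coverTime hlam hfin hB _)) ?_
    filter_upwards [hX.ae_coverTime_ne_top hlam hfin hB] with ω hω
    have e1 : ∀ u : ℝ≥0, (min (u : ℝ≥0∞) (coverTime X B ω)).toReal =
        min (u : ℝ) (coverTime X B ω).toReal := fun u => by
      rw [ENNReal.toReal_min ENNReal.coe_ne_top hω, ENNReal.coe_toReal]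
    simp only [hm, e1, Real.coe_toNNReal _ hr.1.le]
    have hrT := hr.2
    rcases le_total (T : ℝ) (coverTime X B ω).toReal with h | h
    · rw [min_eq_left h, min_eq_left hrT, min_eq_left (hrT.trans h)]
      linarith
    · rw [min_eq_right h]
  have h3 : ∫ ω, m ω ^ 2 / 2 ∂μ ≤ ∫ ω, (∫ r in (0 : ℝ)..T, (m ω - min r (m ω))) ∂μ := by
    have hi : Integrable (fun ω => ∫ r in (0 : ℝ)..T, (m ω - min r (m ω))) μ := by
      simp only [intervalIntegral.integral_of_le T.coe_nonneg]
      exact hprod.integral_prod_right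
    refine integral_mono_of_nonneg (.of_forall fun ω => by positivity) hi
      (.of_forall fun ω => sq_div_two_le_integral (hm0 ω) (hmT ω))
  rw [integral_div] at h3
  linarith

theorem lintegral_sq_coverTime_le (hX : IsGrowthProcess lam μ ℱ X) (hlam : ∀ x, 0 < lam x)
    (hfin : IsLocallyFinite P) (hB : IsLowerSet (B : Set P)) :
    ∫⁻ ω, ENNReal.ofReal ((coverTime X (B : Set P) ω).toReal ^ 2) ∂μ ≤
      ENNReal.ofReal (sqTime lam B ∅) := by
  have hmeas : ∀ n : ℕ, AEStronglyMeasurable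
      (fun ω => (min ((n : ℝ≥0) : ℝ≥0∞) (coverTime X B ω)).toReal ^ 2) μ := fun n =>
    (hX.integrable_min_coverTime hlam hfin hB n).aestronglyMeasurable.pow 2
  refine lintegral_le_of_tendsto (f := fun (n : ℕ) ω =>
    ENNReal.ofReal ((min ((n : ℝ≥0) : ℝ≥0∞) (coverTime X B ω)).toReal ^ 2))
    (fun n => (hmeas n).aemeasurable.ennreal_ofReal) ?_ fun n => ?_
  · filter_upwards [hX.ae_coverTime_ne_top hlam hfin hB] with ω hω
    exact ENNReal.tendsto_ofReal
      (((ENNReal.tendsto_toReal hω).comp (tendsto_min_natCast _)).pow 2)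
  · rw [← ofReal_integral_eq_lintegral_ofReal ?_ (.of_forall fun _ => sq_nonneg _)]
    · exact ENNReal.ofReal_le_ofReal (hX.integral_min_sq_le hlam hfin hB n)
    · refine .of_bound (hmeas n) ((n : ℝ) ^ 2) (.of_forall fun ω => ?_)
      rw [Real.norm_of_nonneg (sq_nonneg _)]
      refine pow_le_pow_left₀ ENNReal.toReal_nonneg ?_ 2
      simpa using ENNReal.toReal_mono ENNReal.coe_ne_top
        (min_le_left ((n : ℝ≥0) : ℝ≥0∞) (coverTime X B ω))

theorem memLp_coverTime (hX : IsGrowthProcess lam μ ℱ X) (hlam : ∀ x, 0 < lam x)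
    (hfin : IsLocallyFinite P) (hB : IsLowerSet (B : Set P)) :
    MemLp (fun ω => (coverTime X (B : Set P) ω).toReal) 2 μ := by
  have h := (hX.integrable_coverTime hlam hfin hB).aestronglyMeasurable
  rw [memLp_two_iff_integrable_sq h]
  exact (lintegral_ofReal_ne_top_iff_integrable (h.pow 2) (.of_forall fun _ => sq_nonneg _)).1
    ((hX.lintegral_sq_coverTime_le hlam hfin hB).trans_lt ENNReal.ofReal_lt_top).ne

theorem integral_sq_coverTime_le (hX : IsGrowthProcess lam μ ℱ X) (hlam : ∀ x, 0 < lam x)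
    (hfin : IsLocallyFinite P) (hB : IsLowerSet (B : Set P)) :
    ∫ ω, (coverTime X (B : Set P) ω).toReal ^ 2 ∂μ ≤ sqTime lam B ∅ := by
  rw [← ENNReal.ofReal_le_ofReal_iff (sqTime_nonneg hlam hB ∅),
    ofReal_integral_eq_lintegral_ofReal (hX.memLp_coverTime hlam hfin hB).integrable_sq
      (.of_forall fun _ => sq_nonneg _)]
  exact hX.lintegral_sq_coverTime_le hlam hfin hB

end IsGrowthProcess

end CoverTime

end CrystalGrowth

end

/-! ### Analytic lemmas for the limits. -/

noncomputable section

namespace CrystalGrowth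

/-- Fekete's lemma, for sequences that are superadditive up to a constant and grow at most
linearly. -/
theorem exists_tendsto_div_of_superadditive {u : ℕ → ℝ} {c K : ℝ} (hK : 0 ≤ K)
    (hu : ∀ m n, u m + u n ≤ u (m + n) + c) (hle : ∀ n : ℕ, u n ≤ K * (n + 1)) :
    ∃ l, Tendsto (fun n : ℕ => u n / n) atTop (𝓝 l) := by
  -- The constant is absorbed by passing to `c - u`. For `n ≥ 1` the growth bound `K * (n + 1) ≤ 2 *
  -- K * n` keeps the quotients bounded below.
  have hsub : Subadditive fun n => c - u n := fun m n => by linarith [hu m n]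
  have hbdd : BddBelow (Set.range fun n : ℕ => (c - u n) / n) := by
    refine ⟨- (|c| + 2 * K), ?_⟩
    rintro _ ⟨n, rfl⟩
    rcases n.eq_zero_or_pos with rfl | hn
    · simp only [Nat.cast_zero, div_zero]
      linarith [abs_nonneg c]
    · have hn' : (1 : ℝ) ≤ n := by exact_mod_cast hn
      rw [le_div_iff₀ (by linarith)]
      nlinarith [hle n, neg_abs_le c, abs_nonneg c]
  refine ⟨0 - hsub.lim, ?_⟩
  have h1 : Tendsto (fun n : ℕ => c / (n : ℝ)) atTop (𝓝 0) :=
    tendsto_const_div_atTop_nhds_zero_nat c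
  refine (h1.sub (hsub.tendsto_lim hbdd)).congr fun n => ?_
  rw [← sub_div]
  ring

/-- Optimization over the exponential parameter. -/
theorem le_sq_of_forall_le {g a k l : ℝ} (ha : 0 ≤ a) (hk : 0 ≤ k) (hl : 0 ≤ l)
    (h : ∀ u, 0 < u → u < 1 → g ≤ a * (k / u + l / (1 - u))) : g ≤ a * (√k + √l) ^ 2 := by
  -- The optimal parameter is `√k / (√k + √l)`, which is not admissible when `k` or `l` vanishes.
  -- Shifting both roots by `ε` keeps it inside `(0, 1)`.
  have key : ∀ ε > 0, g ≤ a * ((√k + ε) + (√l + ε)) ^ 2 := by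
    intro ε hε
    have hx : 0 < √k + ε := by positivity
    have hy : 0 < √l + ε := by positivity
    set x := √k + ε with hxd
    set y := √l + ε with hyd
    have hkx : k ≤ x ^ 2 := by
      rw [← Real.sq_sqrt hk]
      exact pow_le_pow_left₀ (Real.sqrt_nonneg k) (by linarith) 2
    have hly : l ≤ y ^ 2 := by
      rw [← Real.sq_sqrt hl]
      exact pow_le_pow_left₀ (Real.sqrt_nonneg l) (by linarith) 2
    have hu := h (x / (x + y)) (by positivity) ((div_lt_one (by positivity)).2 (by linarith))
    have h1u : 1 - x / (x + y) = y / (x + y) := by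
      field_simp
      ring
    rw [h1u] at hu
    refine hu.trans (mul_le_mul_of_nonneg_left ?_ ha)
    calc k / (x / (x + y)) + l / (y / (x + y))
        ≤ x ^ 2 / (x / (x + y)) + y ^ 2 / (y / (x + y)) := by gcongr
      _ = (x + y) ^ 2 := by
          field_simp
  have hlim : Tendsto (fun ε : ℝ => a * ((√k + ε) + (√l + ε)) ^ 2) (𝓝[>] 0)
      (𝓝 (a * ((√k + 0) + (√l + 0)) ^ 2)) :=
    (Continuous.tendsto (by fun_prop) 0).mono_left nhdsWithin_le_nhds
  simp only [add_zero] at hlim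
  exact ge_of_tendsto hlim (by filter_upwards [self_mem_nhdsWithin] with ε hε using key ε hε)

theorem integral_sq_div_sub {Ω : Type*} [MeasurableSpace Ω] {μ : Measure Ω}
    [IsProbabilityMeasure μ] {f : Ω → ℝ} (hf : MemLp f 2 μ) (x g : ℝ) :
    ∫ ω, (f ω / x - g) ^ 2 ∂μ =
      (∫ ω, f ω ^ 2 ∂μ) / x ^ 2 - 2 * g * ((∫ ω, f ω ∂μ) / x) + g ^ 2 := by
  have h1 : Integrable f μ := hf.integrable one_le_two
  have h2 : Integrable (fun ω => f ω ^ 2) μ := hf.integrable_sq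
  have e : ∀ ω, (f ω / x - g) ^ 2 = f ω ^ 2 / x ^ 2 - 2 * g * (f ω / x) + g ^ 2 := fun ω => by ring
  simp only [e]
  have i1 : Integrable (fun ω => f ω ^ 2 / x ^ 2) μ := h2.div_const _
  have i2 : Integrable (fun ω => 2 * g * (f ω / x)) μ := (h1.div_const _).const_mul _
  have i3 : Integrable (fun ω => f ω ^ 2 / x ^ 2 - 2 * g * (f ω / x)) μ := i1.sub i2
  rw [integral_add i3 (integrable_const _), integral_sub i1 i2, integral_div,
    integral_const_mul, integral_div]
  simp

/-- A law of large numbers in mean square, for variables whose variance grows at most linearly in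
the mean. -/
theorem tendsto_eLpNorm_div_sub {Ω : Type*} [MeasurableSpace Ω] {μ : Measure Ω}
    [IsProbabilityMeasure μ] {f : ℕ → Ω → ℝ} {g c : ℝ} (hf : ∀ n, MemLp (f n) 2 μ)
    (hg : Tendsto (fun n : ℕ => (∫ ω, f n ω ∂μ) / n) atTop (𝓝 g))
    (hvar : ∀ n, ∫ ω, f n ω ^ 2 ∂μ ≤ (∫ ω, f n ω ∂μ) ^ 2 + (∫ ω, f n ω ∂μ) / c) :
    Tendsto (fun n : ℕ => eLpNorm (fun ω => f n ω / n - g) 2 μ) atTop (𝓝 0) := by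
  have hL : ∀ n : ℕ, MemLp (fun ω => f n ω / n - g) 2 μ := fun n => by
    simp only [div_eq_inv_mul]
    exact ((hf n).const_mul _).sub (memLp_const g)
  have h1 : Tendsto (fun n : ℕ => ∫ ω, (f n ω / n - g) ^ 2 ∂μ) atTop (𝓝 0) := by
    -- Squared bias plus a bound on the variance of `f n / n`; the latter is the convergent mean
    -- quotient times `c⁻¹ / n`.
    have h2 : Tendsto (fun n : ℕ => ((∫ ω, f n ω ∂μ) / n - g) ^ 2 +
        (∫ ω, f n ω ∂μ) / n * (c⁻¹ / (n : ℝ))) atTop (𝓝 ((g - g) ^ 2 + g * 0)) :=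
      ((hg.sub_const g).pow 2).add (hg.mul (tendsto_const_div_atTop_nhds_zero_nat _))
    rw [sub_self, mul_zero, add_zero, zero_pow two_ne_zero] at h2
    refine squeeze_zero (fun n => integral_nonneg fun _ => sq_nonneg _) (fun n => ?_) h2
    rw [integral_sq_div_sub (hf n)]
    have h3 := div_le_div_of_nonneg_right (hvar n) (sq_nonneg (n : ℝ))
    have h4 : ((∫ ω, f n ω ∂μ) ^ 2 + (∫ ω, f n ω ∂μ) / c) / (n : ℝ) ^ 2 =
        ((∫ ω, f n ω ∂μ) / n) ^ 2 + (∫ ω, f n ω ∂μ) / n * (c⁻¹ / (n : ℝ)) := by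
      ring
    linarith
  have h2 : ∀ n : ℕ, eLpNorm (fun ω => f n ω / n - g) 2 μ =
      ENNReal.ofReal (√(∫ ω, (f n ω / n - g) ^ 2 ∂μ)) := fun n => by
    rw [(hL n).eLpNorm_eq_integral_rpow_norm two_ne_zero ENNReal.ofNat_ne_top, Real.sqrt_eq_rpow]
    simp
  simp only [h2]
  have h3 := ENNReal.tendsto_ofReal (h1.sqrt)
  simpa using h3

end CrystalGrowth

end

/-! ### The theorem, for the powers of a lower set. -/

open CrystalGrowth in
theorem theorem3p13 {G : Type*} [Group G] [PartialOrder G] [MulLeftMono G] [MulRightMono G]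
    (hfin : CrystalGrowth.IsLocallyFinite (CrystalGrowth.Cone G))
    (hsteady : CrystalGrowth.IsSteady (CrystalGrowth.Cone G))
    (lam : CrystalGrowth.Cone G → ℝ) (hlam : 0 < ⨅ x, lam x) (hanti : Antitone lam)
    {Ω : Type*} [mΩ : MeasurableSpace Ω] (μ : Measure Ω) [IsProbabilityMeasure μ]
    (ℱ : Filtration ℝ≥0 mΩ) (X : ℝ≥0 → Ω → CrystalGrowth.FinLowerSet (CrystalGrowth.Cone G))
    (hX : CrystalGrowth.IsGrowthProcess lam μ ℱ X)
    (A : Set (CrystalGrowth.Cone G)) (hA : A.Finite) (hA' : IsLowerSet A) (hne : A.Nonempty) :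
    (∀ n : ℕ, ∀ᵐ ω ∂μ, CrystalGrowth.coverTime X (CrystalGrowth.lowerPow A n) ω ≠ ∞) ∧
    (∀ n : ℕ,
      MemLp (fun ω => (CrystalGrowth.coverTime X (CrystalGrowth.lowerPow A n) ω).toReal) 2 μ) ∧
    ∃ g k l : ℝ,
      Tendsto (fun n : ℕ =>
        (∫ ω, (CrystalGrowth.coverTime X (CrystalGrowth.lowerPow A n) ω).toReal ∂μ) / (n : ℝ))
        atTop (𝓝 g) ∧
      Tendsto (fun n : ℕ => CrystalGrowth.width (CrystalGrowth.lowerPow A n) / (n : ℝ))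
        atTop (𝓝 k) ∧
      Tendsto (fun n : ℕ => (CrystalGrowth.len (CrystalGrowth.lowerPow A n) : ℝ) / (n : ℝ))
        atTop (𝓝 l) ∧
      g ≤ 1 / (⨅ x, lam x) * (√k + √l) ^ 2 ∧
      Tendsto (fun n : ℕ => eLpNorm (fun ω =>
        (CrystalGrowth.coverTime X (CrystalGrowth.lowerPow A n) ω).toReal / (n : ℝ) - g) 2 μ)
        atTop (𝓝 0) := by
  -- The real infimum of a family unbounded below is `0` by convention, so `hlam` also supplies
  -- boundedness.
  have hc0 : ∀ x, (⨅ x, lam x) ≤ lam x := fun x => ciInf_le (by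
    by_contra h
    rw [Real.iInf_of_not_bddBelow h] at hlam
    exact hlam.false) x
  have hpos : ∀ x, 0 < lam x := fun x => hlam.trans_le (hc0 x)
  set c := ⨅ x, lam x with hc
  have h1A : 1 ∈ A := one_mem_of_lower hA' hne
  have hpf := finite_lowerPow hfin.1 hA
  set B : ℕ → Finset (Cone G) := fun n => (hpf n).toFinset with hBdef
  have hBc : ∀ n, (B n : Set (Cone G)) = lowerPow A n := fun n => (hpf n).coe_toFinset
  have hBl : ∀ n, IsLowerSet (B n : Set (Cone G)) := fun n => hBc n ▸ isLowerSet_lowerPow A n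
  have h1B : ∀ n, 1 ∈ B n := fun n => (hpf n).mem_toFinset.2 (one_mem_lowerPow h1A n)
  have hmem : ∀ n, MemLp (fun ω => (coverTime X (lowerPow A n) ω).toReal) 2 μ := fun n =>
    hBc n ▸ hX.memLp_coverTime hpos hfin (hBl n)
  have hmean : ∀ n, ∫ ω, (coverTime X (lowerPow A n) ω).toReal ∂μ = meanTime lam (B n) ∅ :=
    fun n => hBc n ▸ hX.integral_coverTime hpos hfin (hBl n)
  obtain ⟨K, hK0, hK⟩ := exists_len_lowerPow_le hfin.1 hsteady hA hA'
  obtain ⟨l, hl⟩ := exists_tendsto_div_of_superadditive (u := fun n => (len (lowerPow A n) : ℝ))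
    (c := 1) hK0 (fun m n => by
      exact_mod_cast len_add_le (hpf m) (hpf n) (hpf (m + n)) (one_mem_lowerPow h1A m)
        (one_mem_lowerPow h1A n) (lowerPow_add A m n)) hK
  -- By translation the branching at `1` bounds the branching everywhere. The `+ 1` keeps `D`
  -- positive when `1` has no upper neighbor.
  set D : ℕ := (hfin.2.2 1).toFinset.card + 1 with hD
  have hlogD : 0 ≤ Real.log D := Real.log_natCast_nonneg D
  have hwidth : ∀ n, width (lowerPow A n) ≤ len (lowerPow A n) * Real.log D := fun n => by
    have h := width_le (B := B n) (D := D) (Nat.succ_pos _)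
      (fun x => (Cone.card_upper_le (hfin.2.2 1) (B n) x).trans (Nat.le_succ _)) (h1B n)
      fun x => Cone.isMin_iff
    rwa [hBc] at h
  have hwidthK : ∀ n : ℕ, width (lowerPow A n) ≤ K * Real.log D * (n + 1) := fun n =>
    (hwidth n).trans (by nlinarith [mul_le_mul_of_nonneg_right (hK n) hlogD])
  obtain ⟨k, hk⟩ := exists_tendsto_div_of_superadditive (u := fun n => width (lowerPow A n))
    (c := 0) (mul_nonneg hK0 hlogD) (fun m n => by
      rw [add_zero]
      exact width_add_le (hpf m) (hpf n) (hpf (m + n)) (one_mem_lowerPow h1A m)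
        (one_mem_lowerPow h1A n) (lowerPow_add A m n)) hwidthK
  have hub : ∀ n : ℕ, ∀ u, 0 < u → u < 1 → meanTime lam (B n) ∅ ≤
      1 / c * (width (lowerPow A n) / u + len (lowerPow A n) / (1 - u)) := fun n u h0 h1 => by
    have h := meanTime_le hlam hc0 (hBl n) h0 h1
    rwa [hBc] at h
  -- Linear growth needs no optimal parameter: the constant comes from `hub` at `u = 1 / 2`.
  obtain ⟨g, hg⟩ := exists_tendsto_div_of_superadditive (u := fun n => meanTime lam (B n) ∅)
    (c := 1 / lam 1) (K := 1 / c * (2 * (K * Real.log D) + 2 * K)) (by positivity)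
    (fun m n => meanTime_add_le hpos hanti (hBl m) (hBl n)
      (by rw [hBc, hBc, hBc, lowerPow_add]) (h1B m) (h1B n)) fun n => by
      refine (hub n (1 / 2) (by norm_num) (by norm_num)).trans ?_
      rw [mul_assoc]
      refine mul_le_mul_of_nonneg_left ?_ (by positivity)
      have e1 := hwidthK n
      have e2 := hK n
      norm_num
      linarith
  refine ⟨fun n => hBc n ▸ hX.ae_coverTime_ne_top hpos hfin (hBl n), hmem, g, k, l, ?_, hk, hl, ?_,
    ?_⟩
  · simpa only [hmean] using hg
  · have hk0 : 0 ≤ k := ge_of_tendsto' hk fun n =>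
      div_nonneg (Real.log_natCast_nonneg _) n.cast_nonneg
    have hl0 : 0 ≤ l := ge_of_tendsto' hl fun n => by positivity
    -- The limit in `n` is taken at fixed `u`; the optimization acts on the limits `k` and `l`.
    refine le_sq_of_forall_le (by positivity) hk0 hl0 fun u h0 h1 => ?_
    refine le_of_tendsto_of_tendsto' hg
      (((hk.div_const u).add (hl.div_const (1 - u))).const_mul (1 / c)) fun n => ?_
    refine (div_le_div_of_nonneg_right (hub n u h0 h1) n.cast_nonneg).trans_eq ?_
    ring
  · refine tendsto_eLpNorm_div_sub (c := c) hmem (by simpa only [hmean] using hg) fun n => ?_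
    rw [hmean]
    refine le_trans ?_ (sqTime_le hlam hc0 (hBl n) isLowerSet_empty)
    have h := hX.integral_sq_coverTime_le hpos hfin (hBl n)
    rwa [hBc] at h
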